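/- **Conventions.** $\mathbb R^n$ carries the Euclidean norm, $\mathbf B_r^n(a)$ is the open ball of radius $r$ about $a$, and $\mathbf B_r^n=\mathbf B_r^n(0)$. For a $C^k$ map $g$ on an open set $S\subset\mathbb R^n$, $$\|g\|_{C^k}=\max_{1\le j\le k}\ \sup_{z\in S}\|D^jg(z)\|$$ with operator norms of multilinear maps (the values of $g$ itself do not enter). The singular values of a linear map $L$ are $\sigma_1(L)\ge\sigma_2(L)\ge\cdots$, with the convention $\sigma_0(L)=1$. **Theorem (Splitting Lemma).** Let $k\ge 3$, let $U\subset\mathbb R^n$ be open with $x_0\in U$, and let $f:U\to\mathbb R$ be of class $C^k$ with $\|f\|_{C^k}\le K$ on $U$, $$Df(x_0)=0,\qquad \operatorname{rank}D^2f(x_0)=p .$$ Put $\sigma_p=\sigma_p(D^2f(x_0))$, and suppose that $U$ contains the ball $\mathbf B^n_{r}(x_0)$ with $$r=\frac{1}{2K\left(1+(K+1)^2/\sigma_p^2\right)^{1/2}}$$ ($U=\mathbb R^n$ if $K=0$). Set $$\delta=\frac{\sigma_p^{5/2}}{32(K+1)^{9/2}}\min\left(1,\ \frac{2\sigma_p^2}{3(p^2+p+1)},\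 \frac{\sigma_p^{3/2}}{2(p^2+p+1)}\right).$$ Then there exist a map $\varphi:\mathbf B_\delta^n\to U$ with $\varphi(0)=x_0$ that is a $C^{k-1}$ diffeomorphism onto the open set $\varphi(\mathbf B_\delta^n)$, with $$\|D\varphi(z)\|\le\frac{32(K+1)^5}{\sigma_p^{5/2}}\qquad(z\in\mathbf B^n_\delta),$$ signs $\varepsilon_1,\dots,\varepsilon_p\in\{1,-1\}$, and a function $\alpha:\mathbf B_\delta^{n-p}\to\mathbb R$ of class $C^k$ with $\alpha(0)=0$, $D\alpha(0)=0$, $D^2\alpha(0)=0$, such that $$f\circ\varphi(x,y)=f(x_0)+\sum_{i=1}^p\varepsilon_i x_i^2+\alpha(y)\qquad\text{for all }(x,y)\in\mathbf B_\delta^n,\ x\in\mathbb R^p,\ y\in\mathbb R^{n-p}.$$ Moreover, the same $\varphi$ satisfies $$\|\varphi\|_{C^{k-1}}\le M,$$ where $M=M(K,\sigma_p,k)>0$ is a constant that depends only on $K$, $\sigma_p$, $k$ and the index $p$ (in particular not on $n$, $U$, $x_0$ or $f$). -/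

import Mathlib

open Set Metric

noncomputable section

/-- `ℝⁿ` with the Euclidean norm. -/
abbrev Eucl (n : ℕ) : Type := EuclideanSpace ℝ (Fin n)

/-- `‖g‖_{C^k} ≤ K` on `S`, where `‖g‖_{C^k} = max_{1 ≤ j ≤ k} sup_{z ∈ S} ‖D^j g(z)‖`, the
norms being operator norms of multilinear maps. (The values of `g` itself do not enter.) -/
def CkNormLE {m : ℕ} {F : Type*} [NormedAddCommGroup F] [NormedSpace ℝ F]
    (k : ℕ) (g : Eucl m → F) (S : Set (Eucl m)) (K : ℝ) : Prop :=
  ∀ j : ℕ, 1 ≤ j → j ≤ k → ∀ z ∈ S, ‖iteratedFDeriv ℝ j g z‖ ≤ K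

/-- The second derivative `D²f(x)` as a linear map `ℝⁿ → ℝⁿ` (its matrix is the Hessian matrix):
the derivative of the gradient. -/
def hessMap {n : ℕ} (f : Eucl n → ℝ) (x : Eucl n) : Eucl n →ₗ[ℝ] Eucl n :=
  (fderiv ℝ (gradient f) x).toLinearMap

/-- The singular values `σ₁ ≥ σ₂ ≥ …`, with the convention `σ₀ = 1`.
Mathlib numbers the singular values from zero. -/
def singVal {n : ℕ} (L : Eucl n →ₗ[ℝ] Eucl n) (p : ℕ) : ℝ :=
  if p = 0 then 1 else L.singularValues (p - 1)

/-- The radius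
`σ^{5/2} / (32 (K+1)^{9/2}) · min (1, 2σ² / (3(p²+p+1)), σ^{3/2} / (2(p²+p+1)))`. -/
def splitRadius (K σ : ℝ) (p : ℕ) : ℝ :=
  σ ^ (5 / 2 : ℝ) / (32 * (K + 1) ^ (9 / 2 : ℝ)) *
    min 1 (min (2 * σ ^ 2 / (3 * ((p : ℝ) ^ 2 + p + 1)))
      (σ ^ (3 / 2 : ℝ) / (2 * ((p : ℝ) ^ 2 + p + 1))))

/-- `φ` restricts to a `C^m` diffeomorphism from `S` onto the open set `φ(S)`. -/
def IsCkDiffeoOn {n : ℕ} (m : ℕ) (φ : Eucl n → Eucl n) (S : Set (Eucl n)) : Prop :=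
  ContDiffOn ℝ m φ S ∧ IsOpen (φ '' S) ∧
    ∃ ψ : Eucl n → Eucl n, ContDiffOn ℝ m ψ (φ '' S) ∧ ∀ z ∈ S, ψ (φ z) = z

/-- The coordinates `x ∈ ℝ^p` of `z = (x, y) ∈ ℝ^p × ℝ^q = ℝ^{p+q}`. -/
def fstPart {p q : ℕ} (z : Eucl (p + q)) : Eucl p :=
  WithLp.toLp 2 fun i => z (Fin.castAdd q i)

/-- The coordinates `y ∈ ℝ^q` of `z = (x, y) ∈ ℝ^p × ℝ^q = ℝ^{p+q}`. -/
def sndPart {p q : ℕ} (z : Eucl (p + q)) : Eucl q :=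
  WithLp.toLp 2 fun j => z (Fin.natAdd p j)

end

/-! After a rotation the Hessian at the critical point is diagonal, with entries `d i` nonzero for
the first `p` axes and zero afterwards. For each `i ≤ p` consider the affine slices parallel to the
first `i` axes. Near the origin, `f` restricted to the slice through `z` has a single critical point
`g i z`, found by the inverse function theorem (`exists_isCriticalGraph`). Here `g 0` is the
identity and `g p` depends only on `y`, so `f` is the critical value `f ∘ g p` plus the telescoping
sum of the differences `f ∘ g i - f ∘ g (i + 1)`. Passing from `g i` to `g (i + 1)` eliminates one
variable, and the difference is `d i / 2` times the square of a function `ξ i` with differential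
close to the `i`-th coordinate (`exists_elimination`). Replacing the first `p` coordinates by the `ξ
i` gives a map close to the identity. Its inverse, rescaled to turn the coefficients into signs and
moved back to `x₀`, is `φ`.

The delicate point is that `φ` must be as smooth as the gradient `G`, namely `C^{k-1}`. If `u` is
the signed distance to the critical point along the axis, Taylor expansion gives `ξ = u √β`, where
`β` involves the derivative of `G` and is one order less smooth. But `u β` is an average of values
of `G` along critical graphs, with no loss, and `D(u √β)` can be written through `Du`, `D(u β)` and
`√β` alone (`exists_mul_sqrt`). The residual function `α` is even `C^k`: by the envelope identity
the gradient of `f ∘ g p` is `G ∘ g p`.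

For uniformity, every quantitative lemma fixes its constant before the space and the functions are
chosen, so dimension never enters. The smallness parameter is `ε = K R / σ`, the relative
oscillation of the Hessian on the ball of radius `R`. The radius `δ` is chosen so that `p` errors of
size `30 ε` add up to at most `1 / 2`. -/

/-! ### Calculus of uniform `C^m` bounds, values included. -/

section CkBounded

variable {E F G H : Type*} [NormedAddCommGroup E] [NormedSpace ℝ E] [NormedAddCommGroup F]
  [NormedSpace ℝ F] [NormedAddCommGroup G] [NormedSpace ℝ G] [NormedAddCommGroup H]
  [NormedSpace ℝ H]

/-- `f` is of class `C^m` on the open set `S`, and there it and its derivatives up to order `m`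
are bounded by `C`. -/
structure CkBounded (m : ℕ) (C : ℝ) (f : E → F) (S : Set E) : Prop where
  isOpen : IsOpen S
  contDiffOn : ContDiffOn ℝ m f S
  norm_le : ∀ j ≤ m, ∀ z ∈ S, ‖iteratedFDeriv ℝ j f z‖ ≤ C

namespace CkBounded

variable {m n : ℕ} {C D : ℝ} {f g : E → F} {S T : Set E}

theorem norm_apply_le (h : CkBounded m C f S) {z : E} (hz : z ∈ S) : ‖f z‖ ≤ C := by
  simpa [norm_iteratedFDeriv_zero] using h.norm_le 0 (Nat.zero_le m) z hz

theorem mono (h : CkBounded m C f S) (hn : n ≤ m) (hC : C ≤ D) : CkBounded n D f S :=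
  ⟨h.isOpen, h.contDiffOn.of_le (by exact_mod_cast hn),
    fun j hj z hz => (h.norm_le j (hj.trans hn) z hz).trans hC⟩

theorem mono_set (h : CkBounded m C f S) (hT : IsOpen T) (hTS : T ⊆ S) : CkBounded m C f T :=
  ⟨hT, h.contDiffOn.mono hTS, fun j hj z hz => h.norm_le j hj z (hTS hz)⟩

theorem congr (h : CkBounded m C f S) (hfg : EqOn g f S) : CkBounded m C g S := by
  refine ⟨h.isOpen, h.contDiffOn.congr hfg, fun j hj z hz => ?_⟩
  have : g =ᶠ[nhds z] f := Filter.eventuallyEq_of_mem (h.isOpen.mem_nhds hz) hfg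
  rw [(this.iteratedFDeriv ℝ j).eq_of_nhds]
  exact h.norm_le j hj z hz

theorem differentiableAt (h : CkBounded (m + 1) C f S) {z : E} (hz : z ∈ S) :
    DifferentiableAt ℝ f z :=
  ((h.contDiffOn.contDiffAt (h.isOpen.mem_nhds hz)).differentiableAt (by simp))

theorem norm_fderiv_le (h : CkBounded (m + 1) C f S) {z : E} (hz : z ∈ S) :
    ‖fderiv ℝ f z‖ ≤ C := by
  simpa [norm_iteratedFDeriv_one] using h.norm_le 1 (by omega) z hz

theorem fderiv (h : CkBounded (m + 1) C f S) : CkBounded m C (fderiv ℝ f) S := by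
  refine ⟨h.isOpen, h.contDiffOn.fderiv_of_isOpen h.isOpen (by norm_cast), fun j hj z hz => ?_⟩
  rw [norm_iteratedFDeriv_fderiv]
  exact h.norm_le (j + 1) (by omega) z hz

/-- This drives the inductions on the order: a formula expressing the derivative through functions
already controlled to order `m` gives control to order `m + 1`. -/
theorem of_fderiv (hf : ∀ z ∈ S, ‖f z‖ ≤ C) (hd : ∀ z ∈ S, DifferentiableAt ℝ f z)
    (h : CkBounded m C (_root_.fderiv ℝ f) S) : CkBounded (m + 1) C f S := by
  refine ⟨h.isOpen, ?_, fun j hj z hz => ?_⟩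
  · rw [show ((m + 1 : ℕ) : WithTop ℕ∞) = (m : WithTop ℕ∞) + 1 by norm_cast,
      contDiffOn_succ_iff_fderiv_of_isOpen h.isOpen]
    exact ⟨fun z hz => (hd z hz).differentiableWithinAt, by simp, h.contDiffOn⟩
  · cases j with
    | zero => simpa [norm_iteratedFDeriv_zero] using hf z hz
    | succ j =>
      rw [← norm_iteratedFDeriv_fderiv]
      exact h.norm_le j (by omega) z hz

theorem zero_of_continuousOn (hS : IsOpen S) (hf : ContinuousOn f S) (hb : ∀ z ∈ S, ‖f z‖ ≤ C) :
    CkBounded 0 C f S := by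
  refine ⟨hS, by simpa using (contDiffOn_zero (𝕜 := ℝ)).2 hf, fun j hj z hz => ?_⟩
  obtain rfl : j = 0 := by omega
  simpa [norm_iteratedFDeriv_zero] using hb z hz

theorem bilin (B : F →L[ℝ] G →L[ℝ] H) (hB : ‖B‖ ≤ 1) {g : E → G} (hC : 0 ≤ C)
    (hf : CkBounded m C f S) (hg : CkBounded m D g S) :
    CkBounded m (2 ^ m * C * D) (fun z => B (f z) (g z)) S := by
  refine ⟨hf.isOpen, ?_, fun j hj z hz => ?_⟩
  · exact (B.isBoundedBilinearMap.contDiff).comp_contDiffOn (hf.contDiffOn.prodMk hg.contDiffOn)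
  have hD : 0 ≤ D := (norm_nonneg _).trans (hg.norm_apply_le hz)
  have key := B.norm_iteratedFDerivWithin_le_of_bilinear_of_le_one (n := j) hf.contDiffOn
    hg.contDiffOn hf.isOpen.uniqueDiffOn hz (by exact_mod_cast hj) hB
  simp only [iteratedFDerivWithin_of_isOpen _ hf.isOpen hz] at key
  refine key.trans ?_
  calc _ ≤ ∑ i ∈ Finset.range (j + 1), (j.choose i : ℝ) * C * D := by
        refine Finset.sum_le_sum fun i hi => ?_
        rw [Finset.mem_range] at hi
        have h1 := hf.norm_le i (by omega) z hz
        have h2 := hg.norm_le (j - i) (by omega) z hz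
        gcongr
    _ = 2 ^ j * C * D := by
        rw [← Finset.sum_mul, ← Finset.sum_mul]
        congr 2
        exact_mod_cast Nat.sum_range_choose j
    _ ≤ 2 ^ m * C * D := by gcongr; norm_num

theorem comp {g : F → G} {T : Set F} (hC : 0 ≤ C) (hg : CkBounded m C g T)
    (hf : CkBounded m D f S) (hST : MapsTo f S T) :
    CkBounded m (m.factorial * C * max 1 D ^ m) (fun z => g (f z)) S := by
  refine ⟨hf.isOpen, hg.contDiffOn.comp hf.contDiffOn hST, fun j hj z hz => ?_⟩
  have key := norm_iteratedFDerivWithin_comp_le (n := j) (C := C) (D := max 1 D) hg.contDiffOn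
    hf.contDiffOn (by exact_mod_cast hj) hg.isOpen.uniqueDiffOn hf.isOpen.uniqueDiffOn hST hz
    (fun i hi => by
      rw [iteratedFDerivWithin_of_isOpen _ hg.isOpen (hST hz)]
      exact hg.norm_le i (by omega) _ (hST hz))
    (fun i hi hij => by
      rw [iteratedFDerivWithin_of_isOpen _ hf.isOpen hz]
      refine (hf.norm_le i (by omega) _ hz).trans ((le_max_right 1 D).trans ?_)
      exact le_self_pow₀ (le_max_left _ _) (by omega))
  rw [iteratedFDerivWithin_of_isOpen _ hf.isOpen hz] at key
  refine key.trans ?_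
  have h1 : (1 : ℝ) ≤ max 1 D := le_max_left _ _
  gcongr

theorem clm (L : F →L[ℝ] G) (hL : ‖L‖ ≤ D) (hf : CkBounded m C f S) :
    CkBounded m (D * C) (fun z => L (f z)) S := by
  refine ⟨hf.isOpen, L.contDiff.comp_contDiffOn hf.contDiffOn, fun j hj z hz => ?_⟩
  refine (L.norm_iteratedFDeriv_comp_left (n := j)
    (hf.contDiffOn.contDiffAt (hf.isOpen.mem_nhds hz)) (by exact_mod_cast hj)).trans ?_
  exact mul_le_mul hL (hf.norm_le j hj z hz) (norm_nonneg _) ((norm_nonneg _).trans hL)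

theorem add (hf : CkBounded m C f S) (hg : CkBounded m D g S) :
    CkBounded m (C + D) (fun z => f z + g z) S := by
  refine ⟨hf.isOpen, hf.contDiffOn.add hg.contDiffOn, fun j hj z hz => ?_⟩
  have h1 := (hf.contDiffOn.contDiffAt (hf.isOpen.mem_nhds hz)).of_le
    (show (j : WithTop ℕ∞) ≤ m by exact_mod_cast hj)
  have h2 := (hg.contDiffOn.contDiffAt (hg.isOpen.mem_nhds hz)).of_le
    (show (j : WithTop ℕ∞) ≤ m by exact_mod_cast hj)
  have := iteratedFDeriv_add_apply h1 h2
  rw [show (fun z => f z + g z) = f + g from rfl, this]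
  exact norm_add_le_of_le (hf.norm_le j hj z hz) (hg.norm_le j hj z hz)

theorem neg (hf : CkBounded m C f S) : CkBounded m C (fun z => -f z) S := by
  refine ⟨hf.isOpen, hf.contDiffOn.neg, fun j hj z hz => ?_⟩
  rw [show (fun z => -f z) = -f from rfl, iteratedFDeriv_neg_apply, norm_neg]
  exact hf.norm_le j hj z hz

theorem sub (hf : CkBounded m C f S) (hg : CkBounded m D g S) :
    CkBounded m (C + D) (fun z => f z - g z) S := by
  simpa [sub_eq_add_neg] using hf.add hg.neg

theorem const (hS : IsOpen S) (c : F) (hc : ‖c‖ ≤ C) : CkBounded m C (fun _ : E => c) S := by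
  refine ⟨hS, contDiffOn_const, fun j hj z hz => ?_⟩
  cases j with
  | zero => simpa [norm_iteratedFDeriv_zero] using hc
  | succ j => simpa [iteratedFDeriv_succ_const] using (norm_nonneg c).trans hc

theorem of_clm (hS : IsOpen S) (L : E →L[ℝ] F) (hL : ‖L‖ ≤ C) (hb : ∀ z ∈ S, ‖L z‖ ≤ C) :
    CkBounded m C (fun z => L z) S := by
  cases m with
  | zero => exact zero_of_continuousOn hS L.continuous.continuousOn hb
  | succ m =>
    refine of_fderiv hb (fun z _ => L.differentiableAt) ?_
    exact (const hS L hL).congr fun z _ => L.fderiv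

theorem smul {a : E → ℝ} (hC : 0 ≤ C) (ha : CkBounded m C a S) (hg : CkBounded m D g S) :
    CkBounded m (2 ^ m * C * D) (fun z => a z • g z) S :=
  bilin (ContinuousLinearMap.lsmul ℝ ℝ) ContinuousLinearMap.opNorm_lsmul_le hC ha hg

theorem sum {ι : Type*} (s : Finset ι) {f : ι → E → F} (hS : IsOpen S)
    (hf : ∀ i ∈ s, CkBounded m C (f i) S) :
    CkBounded m (s.card * C) (fun z => ∑ i ∈ s, f i z) S := by
  classical
  induction s using Finset.induction_on with
  | empty => simpa using const (m := m) hS (0 : F) (C := 0) (by simp)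
  | insert a s ha ih =>
    have h1 := (hf a (by simp)).add (ih fun i hi => hf i (by simp [hi]))
    simp only [Finset.sum_insert ha, Finset.card_insert_of_notMem ha]
    exact h1.mono le_rfl (by push_cast; linarith)

/-- The inverse of a uniformly invertible `C^m` family in a Banach algebra. -/
theorem exists_ringInverse (m : ℕ) (C : ℝ) (hC : 0 ≤ C) : ∃ C' : ℝ, 0 ≤ C' ∧
    ∀ {E : Type} {R : Type} [NormedAddCommGroup E] [NormedSpace ℝ E] [NormedRing R]
      [NormedAlgebra ℝ R] [CompleteSpace R] {A J : E → R} {S : Set E},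
      CkBounded m C A S → (∀ z ∈ S, A z * J z = 1) → (∀ z ∈ S, J z * A z = 1) →
      (∀ z ∈ S, ‖J z‖ ≤ C) → CkBounded m C' J S := by
  have cont : ∀ {E : Type} {R : Type} [NormedAddCommGroup E] [NormedSpace ℝ E] [NormedRing R]
      [NormedAlgebra ℝ R] [CompleteSpace R] {A J : E → R} {S : Set E} (m : ℕ),
      CkBounded m C A S → (∀ z ∈ S, A z * J z = 1) → (∀ z ∈ S, J z * A z = 1) →
      ContDiffOn ℝ m J S := by
    intro E R _ _ _ _ _ A J S m hA h1 h2
    have hJ : EqOn J (fun z => Ring.inverse (A z)) S := fun z hz =>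
      (Ring.inverse_unit (⟨A z, J z, h1 z hz, h2 z hz⟩ : Rˣ)).symm
    refine ContDiffOn.congr (fun z hz => ?_) hJ
    exact (contDiffAt_ringInverse ℝ (⟨A z, J z, h1 z hz, h2 z hz⟩ : Rˣ)).comp_contDiffWithinAt z
      (hA.contDiffOn z hz)
  induction m with
  | zero =>
    exact ⟨C, hC, fun hA h1 h2 h3 =>
      zero_of_continuousOn hA.isOpen (cont 0 hA h1 h2).continuousOn h3⟩
  | succ m ih =>
    obtain ⟨C₁, hC₁, ih⟩ := ih
    refine ⟨max C (2 ^ m * (2 ^ m * C₁ * C₁) * C), le_max_of_le_left hC, ?_⟩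
    intro E R _ _ _ _ _ A J S hA h1 h2 h3
    -- `DJ = -J (DA) J`: the right side needs only order `m` bounds on `J`, which the induction
    -- supplies.
    have hd : ∀ z ∈ S, HasFDerivAt J
        (-(ContinuousLinearMap.mulLeftRight ℝ R (J z) (J z)).comp (_root_.fderiv ℝ A z)) z := by
      intro z hz
      have h := (hasFDerivAt_ringInverse (𝕜 := ℝ) (⟨A z, J z, h1 z hz, h2 z hz⟩ : Rˣ)).comp z
        (hA.differentiableAt hz).hasFDerivAt
      have hJ : J =ᶠ[nhds z] (fun z => Ring.inverse (A z)) :=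
        Filter.eventuallyEq_of_mem (hA.isOpen.mem_nhds hz) fun z hz =>
          (Ring.inverse_unit (⟨A z, J z, h1 z hz, h2 z hz⟩ : Rˣ)).symm
      have h' := h.congr_of_eventuallyEq hJ
      simpa using h'
    have hJ : CkBounded m C₁ J S := ih (hA.mono (Nat.le_succ m) le_rfl) h1 h2 h3
    have h4 := hJ.bilin (ContinuousLinearMap.mulLeftRight ℝ R)
      (ContinuousLinearMap.opNorm_mulLeftRight_le ℝ R) hC₁ hJ
    have h5 := (bilin (ContinuousLinearMap.compL ℝ E R R)
      (ContinuousLinearMap.norm_compL_le ℝ E R R) (by positivity) h4 hA.fderiv).neg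
    refine of_fderiv (fun z hz => (h3 z hz).trans (le_max_left _ _))
      (fun z hz => (hd z hz).differentiableAt) ?_
    exact (h5.congr fun z hz => (hd z hz).fderiv).mono le_rfl (le_max_right _ _)

/-- Derivatives of a fixed function are continuous, hence bounded on compacts. It serves for `√x`
and `1 / (2 √x)`, whose bounds then depend on the order alone. -/
theorem exists_of_isCompact {K : Set E} (hK : IsCompact K) {U : Set E} (hU : IsOpen U)
    (hKU : K ⊆ U) (m : ℕ) (hf : ContDiffOn ℝ m f U) :
    ∃ C : ℝ, 0 ≤ C ∧ ∀ S ⊆ K, IsOpen S → CkBounded m C f S := by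
  have : ∀ j : ℕ, ∃ C : ℝ, 0 ≤ C ∧ (j ≤ m → ∀ z ∈ K, ‖iteratedFDeriv ℝ j f z‖ ≤ C) := by
    intro j
    by_cases hj : j ≤ m
    · have hc : ContinuousOn (iteratedFDeriv ℝ j f) U := by
        refine (hf.continuousOn_iteratedFDerivWithin (m := j) (by exact_mod_cast hj)
          hU.uniqueDiffOn).congr fun z hz => (iteratedFDerivWithin_of_isOpen j hU hz).symm
      obtain ⟨C, hC⟩ := hK.exists_bound_of_continuousOn (hc.mono hKU)
      exact ⟨max C 0, le_max_right _ _, fun _ z hz => (hC z hz).trans (le_max_left _ _)⟩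
    · exact ⟨0, le_rfl, fun h => absurd h hj⟩
  choose C hC0 hC using this
  refine ⟨∑ j ∈ Finset.range (m + 1), C j, Finset.sum_nonneg fun j _ => hC0 j, ?_⟩
  refine fun S hSK hS => ⟨hS, hf.mono (hSK.trans hKU), fun j hj z hz => ?_⟩
  exact (hC j hj z (hSK hz)).trans (Finset.single_le_sum (f := C) (fun i _ => hC0 i)
    (Finset.mem_range.2 (by omega)))

end CkBounded

end CkBounded

/-! ### Quantitative inverse function theorem. -/

section LocalInverse

variable {E : Type*} [NormedAddCommGroup E] [NormedSpace ℝ E] [CompleteSpace E]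

/-- Quantitative inverse function theorem for a map whose derivative is close to the identity. -/
theorem exists_inverse_of_norm_fderiv_sub_id_le {Ψ : E → E} {R ε : ℝ} (hR : 0 < R) (hε : 0 ≤ ε)
    (hε' : ε ≤ 1 / 2) (h0 : Ψ 0 = 0) {m : ℕ} (hm : 1 ≤ m) (hΨ : ContDiffOn ℝ m Ψ (ball 0 R))
    (hd : ∀ z ∈ ball (0 : E) R, ‖fderiv ℝ Ψ z - ContinuousLinearMap.id ℝ E‖ ≤ ε) :
    ∃ Γ : E → E, (∀ w ∈ ball (0 : E) ((1 - ε) * R), Γ w ∈ ball (0 : E) R) ∧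
      (∀ w ∈ ball (0 : E) ((1 - ε) * R), Ψ (Γ w) = w) ∧
      (∀ z ∈ ball (0 : E) R, Γ (Ψ z) = z) ∧
      (∀ w ∈ ball (0 : E) ((1 - ε) * R), (1 - ε) * ‖Γ w‖ ≤ ‖w‖) ∧
      ContDiffOn ℝ m Γ (ball 0 ((1 - ε) * R)) ∧
      (∀ w ∈ ball (0 : E) ((1 - ε) * R),
        fderiv ℝ Ψ (Γ w) * fderiv ℝ Γ w = 1 ∧ fderiv ℝ Γ w * fderiv ℝ Ψ (Γ w) = 1) := by
  have hm' : (m : WithTop ℕ∞) ≠ 0 := by exact_mod_cast (by omega : m ≠ 0)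
  have hdiff : ∀ z ∈ ball (0 : E) R, DifferentiableAt ℝ Ψ z := fun z hz =>
    (hΨ.contDiffAt (isOpen_ball.mem_nhds hz)).differentiableAt hm'
  have hlip : ∀ x ∈ ball (0 : E) R, ∀ y ∈ ball (0 : E) R,
      ‖Ψ x - Ψ y - (x - y)‖ ≤ ε * ‖x - y‖ := fun x hx y hy => by
    have := (convex_ball (0 : E) R).norm_image_sub_le_of_norm_hasFDerivWithin_le'
      (φ := ContinuousLinearMap.id ℝ E)
      (fun z hz => (hdiff z hz).hasFDerivAt.hasFDerivWithinAt) hd hy hx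
    simpa using this
  have happ : ApproximatesLinearOn Ψ ((ContinuousLinearEquiv.refl ℝ E : E ≃L[ℝ] E) : E →L[ℝ] E)
      (ball 0 R) ε.toNNReal := fun x hx y hy => by simpa [hε] using hlip x hx y hy
  -- The zero space is separated because its identity has norm `0` instead of `1`.
  have hN : Subsingleton E ∨
      ‖((ContinuousLinearEquiv.refl ℝ E).symm : E →L[ℝ] E)‖₊ = 1 := by
    rcases subsingleton_or_nontrivial E with h | h
    · exact Or.inl h
    · exact Or.inr (by simp)
  have hc : Subsingleton E ∨ ε.toNNReal <
      ‖((ContinuousLinearEquiv.refl ℝ E).symm : E →L[ℝ] E)‖₊⁻¹ := by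
    refine hN.imp id fun h => ?_
    rw [h, inv_one, ← NNReal.coe_lt_coe, Real.coe_toNNReal ε hε, NNReal.coe_one]
    linarith
  set e := happ.toOpenPartialHomeomorph Ψ (ball 0 R) hc isOpen_ball with he
  have hsrc : e.source = ball (0 : E) R := rfl
  have heΨ : ∀ z, e z = Ψ z := fun z => rfl
  have htgt : ∀ w ∈ ball (0 : E) ((1 - ε) * R), w ∈ e.target := by
    intro w hw
    have hz : (0 : E) ∈ ball (0 : E) R := mem_ball_self hR
    rcases hN with h | h
    · rw [Subsingleton.elim w (e 0)]
      exact e.map_source hz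
    · rw [mem_ball_zero_iff] at hw
      have h1 : 0 < 1 - ε := by linarith
      -- The image of the closed ball of radius `b` contains the closed ball of radius `(1 - ε) b`;
      -- this `b` just reaches `w`.
      have hlt : ‖w‖ / (1 - ε) < R := by rw [div_lt_iff₀ h1]; linarith
      refine happ.closedBall_subset_target hc isOpen_ball (b := 0) (ε := ‖w‖ / (1 - ε))
        (by positivity) (closedBall_subset_ball hlt) ?_
      rw [h, h0, mem_closedBall_zero_iff]
      simp only [NNReal.coe_one, inv_one, Real.coe_toNNReal ε hε]
      rw [mul_div_cancel₀ _ h1.ne']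
  have hmaps : ∀ w ∈ ball (0 : E) ((1 - ε) * R), e.symm w ∈ ball (0 : E) R := fun w hw =>
    e.map_target (htgt w hw)
  have hinv : ∀ w ∈ ball (0 : E) ((1 - ε) * R), Ψ (e.symm w) = w := fun w hw =>
    e.right_inv (htgt w hw)
  have hunit : ∀ z ∈ ball (0 : E) R, IsUnit (fderiv ℝ Ψ z) := fun z hz => by
    have : IsUnit (1 - (1 - fderiv ℝ Ψ z)) := by
      apply isUnit_one_sub_of_norm_lt_one
      rw [norm_sub_rev]
      exact (hd z hz).trans_lt (by linarith)
    simpa using this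
  have hcd : ∀ w ∈ ball (0 : E) ((1 - ε) * R), ContDiffAt ℝ m e.symm w := by
    intro w hw
    obtain ⟨u, hu⟩ := hunit _ (hmaps w hw)
    have hd' : HasFDerivAt Ψ ((ContinuousLinearEquiv.unitsEquiv ℝ E u : E ≃L[ℝ] E) : E →L[ℝ] E)
        (e.symm w) := by
      have := (hdiff _ (hmaps w hw)).hasFDerivAt
      rw [← hu] at this
      exact this
    exact e.contDiffAt_symm (htgt w hw) hd'
      (hΨ.contDiffAt (isOpen_ball.mem_nhds (hmaps w hw)))
  refine ⟨e.symm, hmaps, hinv, fun z hz => e.left_inv hz, fun w hw => ?_,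
    fun w hw => (hcd w hw).contDiffWithinAt, fun w hw => ?_⟩
  · have h := hlip _ (hmaps w hw) 0 (mem_ball_self hR)
    rw [hinv w hw, h0] at h
    simp only [sub_zero] at h
    have h2 : ‖e.symm w‖ ≤ ‖w‖ + ‖w - e.symm w‖ := by
      have := norm_sub_le w (w - e.symm w)
      simpa using this
    linarith
  · have h1 := (hdiff _ (hmaps w hw)).hasFDerivAt
    have h2 := ((hcd w hw).differentiableAt hm').hasFDerivAt
    constructor
    · refine HasFDerivAt.unique (f := fun w => Ψ (e.symm w)) (x := w) (h1.comp w h2) ?_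
      refine (hasFDerivAt_id w).congr_of_eventuallyEq ?_
      exact Filter.eventuallyEq_of_mem (isOpen_ball.mem_nhds hw) hinv
    · have h2' : HasFDerivAt e.symm (fderiv ℝ e.symm w) (Ψ (e.symm w)) := by
        rwa [hinv w hw]
      refine HasFDerivAt.unique (f := fun z => e.symm (Ψ z)) (x := e.symm w) (h2'.comp _ h1) ?_
      refine (hasFDerivAt_id _).congr_of_eventuallyEq ?_
      exact Filter.eventuallyEq_of_mem (isOpen_ball.mem_nhds (hmaps w hw))
        fun z hz => e.left_inv hz

-- From `J - 1 = -(A - 1) J` one gets `‖J‖ ≤ 1 + ε ‖J‖`, and `ε ≤ 1 / 2` lets the last term be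
-- absorbed.
omit [CompleteSpace E] in
theorem norm_le_two_of_mul_eq_one {A J : E →L[ℝ] E} {ε : ℝ} (hε' : ε ≤ 1 / 2)
    (hA : ‖A - ContinuousLinearMap.id ℝ E‖ ≤ ε) (h : A * J = 1) :
    ‖J‖ ≤ 2 ∧ ‖J - ContinuousLinearMap.id ℝ E‖ ≤ 2 * ε := by
  have hJ : J - ContinuousLinearMap.id ℝ E = -((A - ContinuousLinearMap.id ℝ E) * J) := by
    change J - 1 = -((A - 1) * J)
    rw [sub_mul, h, one_mul, neg_sub]
  have h1 : ‖J - ContinuousLinearMap.id ℝ E‖ ≤ ε * ‖J‖ := by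
    rw [hJ, norm_neg]
    exact (norm_mul_le _ _).trans (by gcongr)
  have h2 : ‖J‖ ≤ 1 + ‖J - ContinuousLinearMap.id ℝ E‖ := by
    have h3 := norm_add_le (ContinuousLinearMap.id ℝ E) (J - ContinuousLinearMap.id ℝ E)
    rw [add_sub_cancel] at h3
    linarith [ContinuousLinearMap.norm_id_le (𝕜 := ℝ) (E := E)]
  have h0 : 0 ≤ ε := (norm_nonneg _).trans hA
  have h4 : ‖J‖ ≤ 2 := by nlinarith [norm_nonneg J]
  exact ⟨h4, by nlinarith⟩

/-- Uniform bounds for the derivatives of a local inverse. -/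
theorem CkBounded.exists_inverse (m : ℕ) (C : ℝ) (hC : 0 ≤ C) : ∃ C' : ℝ, 0 ≤ C' ∧
    ∀ {E : Type} [NormedAddCommGroup E] [NormedSpace ℝ E] [CompleteSpace E] {Ψ Γ : E → E}
      {S T : Set E}, CkBounded (m + 1) C Ψ S → IsOpen T → MapsTo Γ T S →
      (∀ w ∈ T, DifferentiableAt ℝ Γ w) → (∀ w ∈ T, ‖Γ w‖ ≤ C) → (∀ w ∈ T, ‖_root_.fderiv ℝ Γ w‖ ≤ C) →
      (∀ w ∈ T, _root_.fderiv ℝ Ψ (Γ w) * _root_.fderiv ℝ Γ w = 1 ∧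
        _root_.fderiv ℝ Γ w * _root_.fderiv ℝ Ψ (Γ w) = 1) →
      CkBounded (m + 1) C' Γ T := by
  -- The induction raises only the order known for `Γ`; the order for `Ψ` stays `m + 1`. Since `DΓ`
  -- is the inverse of `DΨ ∘ Γ`, order `n` for `Γ` gives order `n` for `DΓ`.
  suffices ∀ n ≤ m + 1, ∃ C' : ℝ, 0 ≤ C' ∧
    ∀ {E : Type} [NormedAddCommGroup E] [NormedSpace ℝ E] [CompleteSpace E] {Ψ Γ : E → E}
      {S T : Set E}, CkBounded (m + 1) C Ψ S → IsOpen T → MapsTo Γ T S →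
      (∀ w ∈ T, DifferentiableAt ℝ Γ w) → (∀ w ∈ T, ‖Γ w‖ ≤ C) → (∀ w ∈ T, ‖_root_.fderiv ℝ Γ w‖ ≤ C) →
      (∀ w ∈ T, _root_.fderiv ℝ Ψ (Γ w) * _root_.fderiv ℝ Γ w = 1 ∧
        _root_.fderiv ℝ Γ w * _root_.fderiv ℝ Ψ (Γ w) = 1) →
      CkBounded n C' Γ T from this (m + 1) le_rfl
  intro n
  induction n with
  | zero =>
    exact fun _ => ⟨C, hC, fun _ hT _ hd hb _ _ => zero_of_continuousOn hT
      (fun w hw => (hd w hw).continuousAt.continuousWithinAt) hb⟩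
  | succ n ih =>
    intro hn
    obtain ⟨C₁, hC₁, ih⟩ := ih (by omega)
    set D : ℝ := max C (n.factorial * C * max 1 C₁ ^ n) with hD
    have hCD : C ≤ D := le_max_left _ _
    obtain ⟨C₂, hC₂, hinv⟩ := CkBounded.exists_ringInverse n D (hC.trans hCD)
    refine ⟨max C C₂, le_max_of_le_left hC, ?_⟩
    intro E _ _ _ Ψ Γ S T hΨ hT hΓ hd hb hb' hJ
    have h1 : CkBounded n C₁ Γ T := ih hΨ hT hΓ hd hb hb' hJ
    have h2 : CkBounded n C (_root_.fderiv ℝ Ψ) S := hΨ.fderiv.mono (by omega) le_rfl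
    have h3 := (h2.comp hC h1 hΓ).mono le_rfl (le_max_right C _)
    refine of_fderiv (fun w hw => (hb w hw).trans (le_max_left _ _)) hd ?_
    exact (hinv h3 (fun w hw => (hJ w hw).1) (fun w hw => (hJ w hw).2)
      fun w hw => (hb' w hw).trans hCD).mono le_rfl (le_max_right _ _)

end LocalInverse

/-! ### Integrals depending on a parameter. -/

section ParametricIntegral

variable {E V : Type} [NormedAddCommGroup E] [NormedSpace ℝ E] [NormedAddCommGroup V]
  [NormedSpace ℝ V]

theorem CkBounded.continuousOn_slice {m : ℕ} {C : ℝ} {S : Set E} {J : Set ℝ} {F : E × ℝ → V}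
    (hF : CkBounded m C F (S ×ˢ J)) {z : E} (hz : z ∈ S) :
    ContinuousOn (fun s => F (z, s)) J :=
  hF.contDiffOn.continuousOn.comp (by fun_prop) fun s hs => ⟨hz, hs⟩

theorem CkBounded.intervalIntegrable_slice {m : ℕ} {C : ℝ} {S : Set E} {J : Set ℝ} {F : E × ℝ → V}
    (hF : CkBounded m C F (S ×ˢ J)) (hJ : Icc 0 1 ⊆ J) {z : E} (hz : z ∈ S) :
    IntervalIntegrable (fun s => F (z, s)) MeasureTheory.volume 0 1 :=
  ((hF.continuousOn_slice hz).mono (by rwa [uIcc_of_le zero_le_one])).intervalIntegrable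

theorem CkBounded.norm_intervalIntegral_le {m : ℕ} {C : ℝ} {S : Set E} {J : Set ℝ} {F : E × ℝ → V}
    (hF : CkBounded m C F (S ×ˢ J)) (hJ : Icc 0 1 ⊆ J) {z : E} (hz : z ∈ S) :
    ‖∫ s in (0 : ℝ)..1, F (z, s)‖ ≤ C := by
  have := intervalIntegral.norm_integral_le_of_norm_le_const (a := (0 : ℝ)) (b := 1)
    (f := fun s => F (z, s)) (C := C) fun s hs => by
      rw [uIoc_of_le zero_le_one] at hs
      exact hF.norm_apply_le (show (z, s) ∈ S ×ˢ J from ⟨hz, hJ ⟨hs.1.le, hs.2⟩⟩)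
  simpa using this

/-- The partial derivative in the first variable. -/
theorem CkBounded.fderiv_comp_inl {m : ℕ} {C : ℝ} {Ω : Set (E × ℝ)} {F : E × ℝ → V}
    (hF : CkBounded (m + 1) C F Ω) :
    CkBounded m C (fun x => (_root_.fderiv ℝ F x).comp (ContinuousLinearMap.inl ℝ E ℝ)) Ω := by
  have := hF.fderiv.clm ((ContinuousLinearMap.compL ℝ E (E × ℝ) V).flip
    (ContinuousLinearMap.inl ℝ E ℝ)) (D := 1) ?_
  · simpa using this
  · refine ContinuousLinearMap.opNorm_le_bound _ zero_le_one fun L => ?_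
    simp only [ContinuousLinearMap.flip_apply, ContinuousLinearMap.compL_apply]
    refine (ContinuousLinearMap.opNorm_comp_le _ _).trans ?_
    rw [mul_comm]
    gcongr
    exact ContinuousLinearMap.opNorm_le_bound _ zero_le_one fun x => by simp

theorem CkBounded.hasFDerivAt_intervalIntegral {m : ℕ} {C : ℝ} {S : Set E} {J : Set ℝ}
    {F : E × ℝ → V} (hS : IsOpen S) (hF : CkBounded (m + 1) C F (S ×ˢ J)) (hJ : Icc 0 1 ⊆ J)
    {z : E} (hz : z ∈ S) :
    HasFDerivAt (fun z => ∫ s in (0 : ℝ)..1, F (z, s))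
      (∫ s in (0 : ℝ)..1, (_root_.fderiv ℝ F (z, s)).comp (ContinuousLinearMap.inl ℝ E ℝ)) z := by
  have hsub : ∀ s ∈ uIoc (0 : ℝ) 1, s ∈ J := fun s hs => by
    rw [uIoc_of_le zero_le_one] at hs
    exact hJ ⟨hs.1.le, hs.2⟩
  have hF' := hF.fderiv_comp_inl
  refine intervalIntegral.hasFDerivAt_integral_of_dominated_of_fderiv_le (bound := fun _ => C)
    (F := fun z s => F (z, s))
    (F' := fun z s => (_root_.fderiv ℝ F (z, s)).comp (ContinuousLinearMap.inl ℝ E ℝ))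
    (hS.mem_nhds hz) ?_ (hF.intervalIntegrable_slice hJ hz)
    (intervalIntegrable_iff.1 (hF'.intervalIntegrable_slice hJ hz)).aestronglyMeasurable ?_ (by simp) ?_
  · filter_upwards [hS.mem_nhds hz] with x hx
    exact (intervalIntegrable_iff.1 (hF.intervalIntegrable_slice hJ hx)).aestronglyMeasurable
  · exact Filter.Eventually.of_forall fun s hs x hx =>
      hF'.norm_apply_le (show (x, s) ∈ S ×ˢ J from ⟨hx, hsub s hs⟩)
  · refine Filter.Eventually.of_forall fun s hs x hx => ?_
    have h1 := (hF.differentiableAt (show (x, s) ∈ S ×ˢ J from ⟨hx, hsub s hs⟩)).hasFDerivAt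
    exact h1.comp x (hasFDerivAt_prodMk_left x s)

/-- Differentiation under the integral produces the integral of a partial derivative, a function of
the same kind with the same constant. The target `V` varies in the induction because that derivative
is operator-valued. -/
theorem CkBounded.intervalIntegral {m : ℕ} {C : ℝ} {S : Set E} {J : Set ℝ} {F : E × ℝ → V}
    (hS : IsOpen S) (hF : CkBounded m C F (S ×ˢ J)) (hJ : Icc 0 1 ⊆ J) :
    CkBounded m C (fun z => ∫ s in (0 : ℝ)..1, F (z, s)) S := by
  induction m generalizing V with
  | zero =>
    refine zero_of_continuousOn hS (fun z hz => ContinuousAt.continuousWithinAt ?_)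
      fun z hz => hF.norm_intervalIntegral_le hJ hz
    have hsub : ∀ s ∈ uIoc (0 : ℝ) 1, s ∈ J := fun s hs => by
      rw [uIoc_of_le zero_le_one] at hs
      exact hJ ⟨hs.1.le, hs.2⟩
    refine intervalIntegral.continuousAt_of_dominated_interval (bound := fun _ => C) ?_ ?_
      (by simp) ?_
    · filter_upwards [hS.mem_nhds hz] with x hx
      exact (intervalIntegrable_iff.1 (hF.intervalIntegrable_slice hJ hx)).aestronglyMeasurable
    · filter_upwards [hS.mem_nhds hz] with x hx
      exact Filter.Eventually.of_forall fun s hs =>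
        hF.norm_apply_le (show (x, s) ∈ S ×ˢ J from ⟨hx, hsub s hs⟩)
    · refine Filter.Eventually.of_forall fun s hs => ?_
      have h1 : ContinuousAt F (z, s) := (hF.contDiffOn.continuousOn).continuousAt
        (hF.isOpen.mem_nhds ⟨hz, hsub s hs⟩)
      exact ContinuousAt.comp (f := fun x => (x, s)) h1 (by fun_prop)
  | succ m ih =>
    refine of_fderiv (fun z hz => hF.norm_intervalIntegral_le hJ hz)
      (fun z hz => (hF.hasFDerivAt_intervalIntegral hS hJ hz).differentiableAt) ?_
    exact (ih hF.fderiv_comp_inl).congr fun z hz =>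
      (hF.hasFDerivAt_intervalIntegral hS hJ hz).fderiv

end ParametricIntegral

/-! ### Regularity of `u √β`, and integrals along one direction. -/

section Fiber

theorem contDiffOn_inv_two_sqrt (m : ℕ) :
    ContDiffOn ℝ m (fun x : ℝ => 1 / (2 * √x)) (Ioi 0) := by
  intro x hx
  have hx' : x ≠ 0 := ne_of_gt hx
  refine ContDiffAt.contDiffWithinAt (ContDiffAt.div contDiffAt_const
    (contDiffAt_const.mul (contDiffAt_id.sqrt hx')) ?_)
  have : √x ≠ 0 := (Real.sqrt_pos.2 hx).ne'
  simpa using this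

/-- If `u` and `u β` are of class `C^{m+2}` and `β` is of class `C^{m+1}`, then `u √β` is of class
`C^{m+2}`. -/
theorem CkBounded.exists_mul_sqrt (m : ℕ) (C : ℝ) (hC : 0 ≤ C) : ∃ C' : ℝ, 0 ≤ C' ∧
    ∀ {E : Type} [NormedAddCommGroup E] [NormedSpace ℝ E] {u β η : E → ℝ} {S : Set E},
      CkBounded (m + 2) C u S → CkBounded (m + 1) C β S → CkBounded (m + 2) C η S →
      (∀ z ∈ S, η z = u z * β z) → (∀ z ∈ S, β z ∈ Icc (1 / 2 : ℝ) 2) →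
      CkBounded (m + 2) C' (fun z => u z * √(β z)) S ∧
      ∀ z ∈ S, _root_.fderiv ℝ (fun z => u z * √(β z)) z =
        (√(β z) / 2) • _root_.fderiv ℝ u z + (1 / (2 * √(β z))) • _root_.fderiv ℝ η z := by
  -- An interval larger than `[1 / 2, 2]`, so that `β` takes values in its interior, where the
  -- bounds for `√` are available.
  have hsub : Icc (1 / 4 : ℝ) 4 ⊆ Ioi 0 := fun x hx => lt_of_lt_of_le (by norm_num) hx.1
  have hsqrt : ContDiffOn ℝ (m + 1 : ℕ) (fun x : ℝ => √x) (Ioi 0) := fun x hx =>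
    (contDiffAt_id.sqrt (ne_of_gt hx)).contDiffWithinAt
  obtain ⟨C₁, hC₁, h₁⟩ := exists_of_isCompact isCompact_Icc isOpen_Ioi hsub (m + 1) hsqrt
  obtain ⟨C₂, hC₂, h₂⟩ := exists_of_isCompact isCompact_Icc isOpen_Ioi hsub (m + 1)
    (contDiffOn_inv_two_sqrt (m + 1))
  have h₁ := h₁ _ Ioo_subset_Icc_self isOpen_Ioo
  have h₂ := h₂ _ Ioo_subset_Icc_self isOpen_Ioo
  refine ⟨max (C * 2) (2 ^ (m + 1) * (1 / 2 * ((m + 1).factorial * C₁ * max 1 C ^ (m + 1))) * C +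
    2 ^ (m + 1) * ((m + 1).factorial * C₂ * max 1 C ^ (m + 1)) * C),
    le_max_of_le_left (by positivity), ?_⟩
  intro E _ _ u β η S hu hβ hη hmul hβI
  have hmaps : MapsTo β S (Ioo (1 / 4 : ℝ) 4) := fun z hz =>
    ⟨lt_of_lt_of_le (by norm_num) (hβI z hz).1, lt_of_le_of_lt (hβI z hz).2 (by norm_num)⟩
  have hpos : ∀ z ∈ S, 0 < β z := fun z hz => lt_of_lt_of_le (by norm_num) (hβI z hz).1
  -- The product rule leaves `u Dβ / (2 √β)`, and `u Dβ = Dη - β Du` eliminates `Dβ`. Only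
  -- undifferentiated `β` remains, so no order is lost.
  have hd : ∀ z ∈ S, HasFDerivAt (fun z => u z * √(β z))
      ((√(β z) / 2) • _root_.fderiv ℝ u z + (1 / (2 * √(β z))) • _root_.fderiv ℝ η z) z := by
    intro z hz
    have h1 := (hu.differentiableAt hz).hasFDerivAt
    have h2 := (hβ.differentiableAt hz).hasFDerivAt
    have h3 := h1.mul (h2.sqrt (hpos z hz).ne')
    have h4 : _root_.fderiv ℝ η z = u z • _root_.fderiv ℝ β z + β z • _root_.fderiv ℝ u z := by
      refine ((h1.mul h2).congr_of_eventuallyEq ?_).fderiv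
      exact Filter.eventuallyEq_of_mem (hu.isOpen.mem_nhds hz) hmul
    refine HasFDerivAt.congr_fderiv h3 ?_
    rw [h4]
    have hs : √(β z) ≠ 0 := (Real.sqrt_pos.2 (hpos z hz)).ne'
    have hsq : β z = √(β z) * √(β z) := (Real.mul_self_sqrt (hpos z hz).le).symm
    ext v
    simp only [add_apply, smul_apply, smul_eq_mul]
    generalize √(β z) = w at hs hsq
    rw [hsq]
    field_simp
    ring
  refine ⟨?_, fun z hz => (hd z hz).fderiv⟩
  have h5 := (h₁.comp hC₁ hβ hmaps).clm ((1 / 2 : ℝ) • ContinuousLinearMap.id ℝ ℝ)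
    (D := 1 / 2) (by simp [norm_smul])
  have h6 := h₂.comp hC₂ hβ hmaps
  have h7 := (h5.smul (by positivity) hu.fderiv).add (h6.smul (by positivity) hη.fderiv)
  refine of_fderiv (m := m + 1) (fun z hz => ?_) (fun z hz => (hd z hz).differentiableAt)
    ((h7.mono le_rfl (le_max_right _ _)).congr fun z hz => ?_)
  · refine le_trans ?_ (le_max_left _ _)
    rw [norm_mul]
    refine mul_le_mul (hu.norm_apply_le hz) ?_ (norm_nonneg _) hC
    rw [Real.norm_of_nonneg (Real.sqrt_nonneg _), Real.sqrt_le_left (by norm_num)]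
    exact (hβI z hz).2.trans (by norm_num)
  · rw [(hd z hz).fderiv]
    congr 2
    simp [div_eq_inv_mul]

/-- The parameter ranges over an open interval around `[0, 1]`, so that the domain is open and full
derivatives in `(z, s)` exist at the endpoints too. -/
theorem CkBounded.exists_sub_smul (m : ℕ) (C : ℝ) (hC : 1 ≤ C) : ∃ C' : ℝ, 0 ≤ C' ∧
    ∀ {E : Type} [NormedAddCommGroup E] [NormedSpace ℝ E] {u : E → ℝ} {S : Set E} {e : E},
      ‖e‖ ≤ 1 → (∀ z ∈ S, ‖z‖ ≤ C) → CkBounded m C u S →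
      CkBounded m C' (fun x : E × ℝ => x.1 - (x.2 * u x.1) • e) (S ×ˢ Ioo (-1 / 4 : ℝ) (5 / 4)) ∧
      CkBounded m C' (fun x : E × ℝ => x.2) (S ×ˢ Ioo (-1 / 4 : ℝ) (5 / 4)) := by
  have hC0 : 0 ≤ C := zero_le_one.trans hC
  refine ⟨max (C + 2 ^ m * (2 ^ m * (C + 1) * (m.factorial * C * max 1 C ^ m)) * 1) (C + 1),
    le_max_of_le_right (by positivity), ?_⟩
  intro E _ _ u S e he hS hu
  have hopen : IsOpen (S ×ˢ Ioo (-1 / 4 : ℝ) (5 / 4)) := hu.isOpen.prod isOpen_Ioo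
  have h1 : CkBounded m C (fun x : E × ℝ => x.1) (S ×ˢ Ioo (-1 / 4 : ℝ) (5 / 4)) :=
    of_clm hopen (ContinuousLinearMap.fst ℝ E ℝ)
      ((ContinuousLinearMap.norm_fst_le ℝ E ℝ).trans hC) fun x hx => hS _ hx.1
  have h2 : CkBounded m (C + 1) (fun x : E × ℝ => x.2) (S ×ˢ Ioo (-1 / 4 : ℝ) (5 / 4)) :=
    of_clm hopen (ContinuousLinearMap.snd ℝ E ℝ)
      ((ContinuousLinearMap.norm_snd_le ℝ E ℝ).trans (by linarith)) fun x hx => by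
        have := hx.2
        rw [ContinuousLinearMap.coe_snd', Real.norm_eq_abs, abs_le]
        exact ⟨by linarith [this.1], by linarith [this.2]⟩
  have h3 := hu.comp hC0 h1 fun x hx => hx.1
  have h4 := h1.sub ((h2.smul (by positivity) h3).smul (by positivity) (const hopen e he))
  exact ⟨h4.mono le_rfl (le_max_left _ _), h2.mono le_rfl (le_max_right _ _)⟩

theorem norm_clm_apply_le_one {E V : Type*} [NormedAddCommGroup E] [NormedSpace ℝ E]
    [NormedAddCommGroup V] [NormedSpace ℝ V] {e : E} (he : ‖e‖ ≤ 1) :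
    ‖ContinuousLinearMap.apply ℝ V e‖ ≤ 1 := by
  refine ContinuousLinearMap.opNorm_le_bound _ zero_le_one fun L => ?_
  rw [ContinuousLinearMap.apply_apply, one_mul]
  exact (L.le_opNorm e).trans (mul_le_of_le_one_right (norm_nonneg _) he)

theorem CkBounded.exists_comp_sub_smul (m : ℕ) (C : ℝ) (hC : 1 ≤ C) : ∃ C' : ℝ, 0 ≤ C' ∧
    ∀ {E : Type} [NormedAddCommGroup E] [NormedSpace ℝ E] {h u : E → ℝ} {S W : Set E} {e : E},
      ‖e‖ ≤ 1 → (∀ z ∈ S, ‖z‖ ≤ C) → CkBounded (m + 1) C h W → CkBounded (m + 1) C u S →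
      (∀ z ∈ S, ∀ s ∈ Ioo (-1 / 4 : ℝ) (5 / 4), z - (s * u z) • e ∈ W) →
      CkBounded (m + 1) C' (fun x : E × ℝ => h (x.1 - (x.2 * u x.1) • e))
        (S ×ˢ Ioo (-1 / 4 : ℝ) (5 / 4)) ∧
      CkBounded m C' (fun x : E × ℝ => x.2 * _root_.fderiv ℝ h (x.1 - (x.2 * u x.1) • e) e)
        (S ×ˢ Ioo (-1 / 4 : ℝ) (5 / 4)) := by
  have hC0 : 0 ≤ C := zero_le_one.trans hC
  obtain ⟨C₁, hC₁, h₁⟩ := exists_sub_smul (m + 1) C hC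
  refine ⟨max ((m + 1).factorial * C * max 1 C₁ ^ (m + 1))
    (2 ^ m * C₁ * (1 * (m.factorial * C * max 1 C₁ ^ m))),
    le_max_of_le_left (by positivity), ?_⟩
  intro E _ _ h u S W e he hS hh hu hW
  obtain ⟨h2, h3⟩ := h₁ he hS hu
  have hmaps : MapsTo (fun x : E × ℝ => x.1 - (x.2 * u x.1) • e)
    (S ×ˢ Ioo (-1 / 4 : ℝ) (5 / 4)) W := fun x hx => hW _ hx.1 _ hx.2
  refine ⟨(hh.comp hC0 h2 hmaps).mono le_rfl (le_max_left _ _), ?_⟩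
  have h4 := (hh.fderiv.comp hC0 (h2.mono (Nat.le_succ m) le_rfl) hmaps).clm
    (ContinuousLinearMap.apply ℝ ℝ e) (norm_clm_apply_le_one he)
  exact ((h3.mono (Nat.le_succ m) le_rfl).smul hC₁ h4).mono le_rfl (le_max_right _ _)

/-- Integration by parts with `s ↦ s h (z - s u e)`: the boundary term at `0` vanishes through the
factor `s`, the one at `1` through `h0`. This exhibits `u` as a factor of the average of `h`. -/
theorem integral_comp_sub_smul_eq {E : Type*} [NormedAddCommGroup E] [NormedSpace ℝ E]
    {h : E → ℝ} {W : Set E} {z e : E} {u : ℝ} (hW : IsOpen W) (hh : ContDiffOn ℝ 1 h W)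
    (hseg : ∀ s ∈ Icc (0 : ℝ) 1, z - (s * u) • e ∈ W) (h0 : h (z - u • e) = 0) :
    ∫ s in (0 : ℝ)..1, h (z - (s * u) • e) =
      u * ∫ s in (0 : ℝ)..1, s * fderiv ℝ h (z - (s * u) • e) e := by
  have hcont : Continuous fun s : ℝ => z - (s * u) • e := by fun_prop
  have c1 : ContinuousOn (fun s : ℝ => h (z - (s * u) • e)) (uIcc 0 1) := by
    rw [uIcc_of_le zero_le_one]
    exact hh.continuousOn.comp hcont.continuousOn hseg
  have c2 : ContinuousOn (fun s : ℝ => s * fderiv ℝ h (z - (s * u) • e) e) (uIcc 0 1) := by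
    rw [uIcc_of_le zero_le_one]
    refine continuousOn_id.mul (ContinuousOn.clm_apply ?_ continuousOn_const)
    exact (hh.continuousOn_fderiv_of_isOpen hW le_rfl).comp hcont.continuousOn hseg
  have hd : ∀ s ∈ uIcc (0 : ℝ) 1, HasDerivAt (fun s : ℝ => s * h (z - (s * u) • e))
      (h (z - (s * u) • e) - u * (s * fderiv ℝ h (z - (s * u) • e) e)) s := by
    intro s hs
    rw [uIcc_of_le zero_le_one] at hs
    have d1 : HasDerivAt (fun s : ℝ => z - (s * u) • e) (-(u • e)) s := by
      simpa using (((hasDerivAt_id s).mul_const u).smul_const e).const_sub z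
    have d2 := (((hh.contDiffAt (hW.mem_nhds (hseg s hs))).differentiableAt
      one_ne_zero).hasFDerivAt).comp_hasDerivAt s d1
    have d3 := (hasDerivAt_id s).mul d2
    refine HasDerivAt.congr_deriv d3 ?_
    simp only [id, map_neg, map_smul, smul_eq_mul, Function.comp]
    ring
  have key := intervalIntegral.integral_eq_sub_of_hasDerivAt hd
    (c1.intervalIntegrable.sub (c2.intervalIntegrable.const_mul u))
  rw [intervalIntegral.integral_sub c1.intervalIntegrable (c2.intervalIntegrable.const_mul u),
    intervalIntegral.integral_const_mul] at key
  simp only [one_mul, h0, zero_mul, sub_zero] at key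
  linarith

end Fiber

/-! ### The normal form in one variable with parameters. -/

section Fiber

theorem integral_half_sub_one : ∫ s in (0 : ℝ)..1, (1 - s) = 1 / 2 := by
  rw [intervalIntegral.integral_sub (by simp) (by simp)]
  norm_num

theorem integral_id_unit : ∫ s in (0 : ℝ)..1, s = 1 / 2 := by norm_num

/-- The derivative of `h (z - (s u) e)` when `Dh ≈ lam ℓ` and `Du ≈ ℓ`. -/
theorem norm_comp_sub_smul_sub_le {E : Type*} [NormedAddCommGroup E] [NormedSpace ℝ E] {e : E}
    {ℓ a b : E →L[ℝ] ℝ} {lam ε s : ℝ} (he : ‖e‖ ≤ 1) (hℓ : ‖ℓ‖ ≤ 1) (hℓe : ℓ e = 1)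
    (hε0 : 0 ≤ ε) (hε : ε ≤ 1 / 60) (ha : ‖a - lam • ℓ‖ ≤ 4 * ε * |lam|) (hb : ‖b - ℓ‖ ≤ 2 * ε)
    (hs : s ∈ Icc (0 : ℝ) 1) :
    ‖(a - (s * a e) • b) - (lam * (1 - s)) • ℓ‖ ≤ 11 * ε * |lam| := by
  set a' := a - lam • ℓ with ha'
  set d := b - ℓ with hd
  have hae : |a' e| ≤ 4 * ε * |lam| :=
    (a'.le_opNorm e).trans ((mul_le_of_le_one_right (norm_nonneg _) he).trans ha)
  have hae2 : a e = lam + a' e := by simp [ha', hℓe]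
  have hsplit : (a - (s * a e) • b) - (lam * (1 - s)) • ℓ =
      a' - s • (lam • d + a' e • (ℓ + d)) := by
    rw [hae2]
    have h1 : a = a' + lam • ℓ := by simp [ha']
    have h2 : b = ℓ + d := by simp [hd]
    rw [h2]
    nth_rewrite 1 [h1]
    module
  rw [hsplit]
  have h3 : ‖lam • d + a' e • (ℓ + d)‖ ≤ |lam| * (2 * ε) + 4 * ε * |lam| * (1 + 2 * ε) := by
    refine norm_add_le_of_le ?_ ?_
    · rw [norm_smul, Real.norm_eq_abs]
      gcongr
    · rw [norm_smul, Real.norm_eq_abs]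
      have := norm_add_le_of_le hℓ hb
      gcongr
  have h4 : ‖s • (lam • d + a' e • (ℓ + d))‖ ≤ |lam| * (2 * ε) + 4 * ε * |lam| * (1 + 2 * ε) := by
    rw [norm_smul, Real.norm_eq_abs, abs_of_nonneg hs.1]
    exact (mul_le_of_le_one_left (norm_nonneg _) hs.2).trans h3
  -- The total is `(10 ε + 8 ε²) |lam|`, and `ε ≤ 1 / 60`.
  refine (norm_sub_le_of_le ha h4).trans ?_
  have h5 : 0 ≤ ε * |lam| := by positivity
  nlinarith [mul_nonneg h5 hε0, mul_nonneg h5 (sub_nonneg.2 hε)]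

/-- `√β` and `1 / √β` for `β` close to `1`. -/
theorem abs_sqrt_sub_one_le {β ε : ℝ} (hε : ε ≤ 1 / 60) (hβ : |β - 1| ≤ 8 * ε) :
    |√β - 1| ≤ 8 * ε ∧ |1 / √β - 1| ≤ 9 * ε := by
  rw [abs_le] at hβ
  have hβ1 : (0.81 : ℝ) ≤ β := by linarith
  have hr : 0.9 ≤ √β := Real.le_sqrt_of_sq_le (by norm_num; linarith)
  have hsq : √β * √β = β := Real.mul_self_sqrt (by linarith)
  have hε0 : 0 ≤ ε := by linarith
  have h1 : |√β - 1| ≤ 8 * ε := by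
    rw [abs_le]
    constructor <;> nlinarith
  refine ⟨h1, ?_⟩
  have hpos : 0 < √β := by linarith
  have h2 : 1 / √β - 1 = -((√β - 1) / √β) := by field_simp; ring
  rw [h2, abs_neg, abs_div, abs_of_pos hpos, div_le_iff₀ hpos]
  refine h1.trans ?_
  nlinarith

/-- Combining the two halves of the derivative of `u √β`. -/
theorem norm_half_smul_add_half_smul_sub_le {V : Type*} [NormedAddCommGroup V] [NormedSpace ℝ V]
    {ℓ b c : V} {β ε : ℝ} (hε0 : 0 ≤ ε) (hε : ε ≤ 1 / 60) (hℓ : ‖ℓ‖ ≤ 1)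
    (hβ : |β - 1| ≤ 8 * ε) (hb : ‖b - ℓ‖ ≤ 2 * ε) (hc : ‖c - ℓ‖ ≤ 22 * ε) :
    ‖((√β / 2) • b + (1 / (2 * √β)) • c) - ℓ‖ ≤ 30 * ε := by
  obtain ⟨h1, h2⟩ := abs_sqrt_sub_one_le hε hβ
  set r := √β
  set t := 1 / r with ht
  have hr : |r| ≤ 1 + 8 * ε := by
    have := abs_add_le 1 (r - 1)
    rw [add_sub_cancel, abs_one] at this
    linarith
  have ht' : |t| ≤ 1 + 9 * ε := by
    have := abs_add_le 1 (t - 1)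
    rw [add_sub_cancel, abs_one] at this
    linarith
  have hsplit : ((r / 2) • b + (1 / (2 * r)) • c) - ℓ =
      (1 / 2 : ℝ) • ((r • (b - ℓ) + (r - 1) • ℓ) + (t • (c - ℓ) + (t - 1) • ℓ)) := by
    have : 1 / (2 * r) = t / 2 := by rw [ht]; field_simp
    rw [this]
    module
  rw [hsplit, norm_smul]
  have e1 : ‖r • (b - ℓ)‖ ≤ (1 + 8 * ε) * (2 * ε) := by
    rw [norm_smul, Real.norm_eq_abs]; gcongr
  have e2 : ‖(r - 1) • ℓ‖ ≤ 8 * ε * 1 := by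
    rw [norm_smul, Real.norm_eq_abs]; gcongr
  have e3 : ‖t • (c - ℓ)‖ ≤ (1 + 9 * ε) * (22 * ε) := by
    rw [norm_smul, Real.norm_eq_abs]; gcongr
  have e4 : ‖(t - 1) • ℓ‖ ≤ 9 * ε * 1 := by
    rw [norm_smul, Real.norm_eq_abs]; gcongr
  have e5 := norm_add_le_of_le (norm_add_le_of_le e1 e2) (norm_add_le_of_le e3 e4)
  have : ‖(1 / 2 : ℝ)‖ = 1 / 2 := by norm_num
  rw [this]
  nlinarith [mul_nonneg hε0 (sub_nonneg.2 hε)]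

/-- The one-variable normal form with parameters: `h` plays the part of the derivative in the
direction `e`, and `u` measures the distance to its zero. -/
theorem CkBounded.exists_fiber (m : ℕ) (C : ℝ) (hC : 1 ≤ C) : ∃ C' : ℝ, 0 ≤ C' ∧
    ∀ {E : Type} [NormedAddCommGroup E] [NormedSpace ℝ E] {h u : E → ℝ} {S W : Set E} {e : E}
      {ℓ : E →L[ℝ] ℝ} {lam ε : ℝ},
      ‖e‖ ≤ 1 → ‖ℓ‖ ≤ 1 → ℓ e = 1 → lam ≠ 0 → |lam|⁻¹ ≤ C → 0 ≤ ε → ε ≤ 1 / 60 →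
      (∀ z ∈ S, ‖z‖ ≤ C) → CkBounded (m + 2) C h W → CkBounded (m + 2) C u S →
      (∀ z ∈ S, ∀ s ∈ Ioo (-1 / 4 : ℝ) (5 / 4), z - (s * u z) • e ∈ W) →
      (∀ z ∈ S, h (z - u z • e) = 0) →
      (∀ w ∈ W, ‖_root_.fderiv ℝ h w - lam • ℓ‖ ≤ 4 * ε * |lam|) →
      (∀ z ∈ S, ‖_root_.fderiv ℝ u z - ℓ‖ ≤ 2 * ε) →
      ∃ ξ : E → ℝ, CkBounded (m + 2) C' ξ S ∧ (∀ z ∈ S, ‖_root_.fderiv ℝ ξ z - ℓ‖ ≤ 30 * ε) ∧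
        (∀ z ∈ S, lam / 2 * ξ z ^ 2 = u z * ∫ s in (0 : ℝ)..1, h (z - (s * u z) • e)) ∧
        ∀ z ∈ S, u z = 0 → ξ z = 0 := by
  obtain ⟨C₁, hC₁, h₁⟩ := exists_comp_sub_smul (m + 1) C hC
  have hC0 : 0 ≤ C := zero_le_one.trans hC
  set D : ℝ := max C (2 * C * C₁) with hD
  have hD0 : 0 ≤ D := le_max_of_le_left hC0
  obtain ⟨C', hC', h₂⟩ := exists_mul_sqrt m D hD0
  refine ⟨C', hC', ?_⟩
  intro E _ _ h u S W e ℓ lam ε he hℓ hℓe hlam hlamC hε0 hε hS hh hu hW hzero hDh hDu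
  obtain ⟨hF, hB⟩ := h₁ he hS hh hu hW
  have hJ : Icc (0 : ℝ) 1 ⊆ Ioo (-1 / 4 : ℝ) (5 / 4) := fun s hs =>
    ⟨by linarith [hs.1], by linarith [hs.2]⟩
  have hlam2 : ‖(2 / lam) • ContinuousLinearMap.id ℝ ℝ‖ ≤ 2 * C := by
    rw [norm_smul, ContinuousLinearMap.norm_id, mul_one, Real.norm_eq_abs, abs_div, abs_two,
      div_eq_mul_inv]
    gcongr
  -- `lam / 2 * ξ ^ 2 = u ∫ h` with `η = u β` forces `ξ = u √β`. The factor `2 / lam` makes `β ≈ 1`,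
  -- as `∫ s lam = lam / 2`. `η` keeps all the derivatives of `h`; `β` has one fewer.
  set η : E → ℝ := fun z => 2 / lam * ∫ s in (0 : ℝ)..1, h (z - (s * u z) • e) with hη
  set β : E → ℝ := fun z =>
    2 / lam * ∫ s in (0 : ℝ)..1, s * _root_.fderiv ℝ h (z - (s * u z) • e) e with hβ
  have cη : CkBounded (m + 2) D η S :=
    ((hF.intervalIntegral hu.isOpen hJ).clm _ hlam2).mono le_rfl (le_max_right _ _)
  have cβ : CkBounded (m + 1) D β S :=
    ((hB.intervalIntegral hu.isOpen hJ).clm _ hlam2).mono le_rfl (le_max_right _ _)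
  have hmul : ∀ z ∈ S, η z = u z * β z := fun z hz => by
    have := integral_comp_sub_smul_eq hh.isOpen (hh.contDiffOn.of_le (by norm_cast; omega))
      (fun s hs => hW z hz s (hJ hs)) (hzero z hz)
    simp only [hη, hβ, this]
    ring
  have habs : 0 < |lam| := abs_pos.2 hlam
  have hβ1 : ∀ z ∈ S, |β z - 1| ≤ 8 * ε := by
    intro z hz
    have i1 := hB.intervalIntegrable_slice hJ hz
    have i2 : IntervalIntegrable (fun s : ℝ => s * lam) MeasureTheory.volume 0 1 := by
      apply Continuous.intervalIntegrable; fun_prop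
    have e1 : β z - 1 = 2 / lam * ∫ s in (0 : ℝ)..1,
        (s * _root_.fderiv ℝ h (z - (s * u z) • e) e - s * lam) := by
      rw [intervalIntegral.integral_sub i1 i2, intervalIntegral.integral_mul_const,
        integral_id_unit, mul_sub, show 2 / lam * (1 / 2 * lam) = 1 by field_simp]
    have e2 : |∫ s in (0 : ℝ)..1, (s * _root_.fderiv ℝ h (z - (s * u z) • e) e - s * lam)| ≤
        4 * ε * |lam| := by
      have := intervalIntegral.norm_integral_le_of_norm_le_const (a := (0 : ℝ)) (b := 1)
        (f := fun s => s * _root_.fderiv ℝ h (z - (s * u z) • e) e - s * lam)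
        (C := 4 * ε * |lam|) fun s hs => by
          rw [uIoc_of_le zero_le_one] at hs
          have hs' : s ∈ Icc (0 : ℝ) 1 := ⟨hs.1.le, hs.2⟩
          have h3 := (_root_.fderiv ℝ h (z - (s * u z) • e) - lam • ℓ).le_of_opNorm_le
            (hDh _ (hW z hz s (hJ hs'))) e
          simp only [sub_apply, smul_apply, hℓe, smul_eq_mul, mul_one] at h3
          rw [← mul_sub, norm_mul, Real.norm_of_nonneg hs'.1]
          refine (mul_le_of_le_one_left (norm_nonneg _) hs'.2).trans (h3.trans ?_)
          exact mul_le_of_le_one_right (by positivity) he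
      simpa using this
    rw [e1, abs_mul, abs_div, abs_two, div_mul_eq_mul_div, div_le_iff₀ habs]
    linarith
  have hβI : ∀ z ∈ S, β z ∈ Icc (1 / 2 : ℝ) 2 := fun z hz => by
    have := abs_le.1 (hβ1 z hz)
    constructor <;> linarith
  obtain ⟨h3, h4⟩ := h₂ (hu.mono le_rfl (le_max_left _ _)) cβ cη hmul hβI
  refine ⟨fun z => u z * √(β z), h3, fun z hz => ?_, fun z hz => ?_, fun z hz hz0 => ?_⟩
  · rw [h4 z hz]
    refine norm_half_smul_add_half_smul_sub_le hε0 hε hℓ (hβ1 z hz) (hDu z hz) ?_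
    have hF' := hF.fderiv_comp_inl
    have d1 := (hF.hasFDerivAt_intervalIntegral hu.isOpen hJ hz).const_mul (2 / lam)
    have i1 := hF'.intervalIntegrable_slice hJ hz
    have i2 : IntervalIntegrable (fun s : ℝ => (lam * (1 - s)) • ℓ) MeasureTheory.volume 0 1 := by
      apply Continuous.intervalIntegrable; fun_prop
    -- The model integrand `lam (1 - s) ℓ` integrates to `(lam / 2) ℓ`, so `ℓ` can be put under the
    -- integral; the pointwise error `11 ε |lam|` then becomes `22 ε`.
    have e1 : _root_.fderiv ℝ η z - ℓ = (2 / lam) • ∫ s in (0 : ℝ)..1,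
        ((_root_.fderiv ℝ (fun x : E × ℝ => h (x.1 - (x.2 * u x.1) • e)) (z, s)).comp
          (ContinuousLinearMap.inl ℝ E ℝ) - (lam * (1 - s)) • ℓ) := by
      rw [intervalIntegral.integral_sub i1 i2, intervalIntegral.integral_smul_const,
        intervalIntegral.integral_const_mul, integral_half_sub_one, smul_sub, d1.fderiv, smul_smul]
      congr 1
      rw [show 2 / lam * (lam * (1 / 2)) = 1 by field_simp, one_smul]
    have e2 := intervalIntegral.norm_integral_le_of_norm_le_const (a := (0 : ℝ)) (b := 1)
      (f := fun s => (_root_.fderiv ℝ (fun x : E × ℝ => h (x.1 - (x.2 * u x.1) • e)) (z, s)).comp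
          (ContinuousLinearMap.inl ℝ E ℝ) - (lam * (1 - s)) • ℓ)
      (C := 11 * ε * |lam|) fun s hs => by
        rw [uIoc_of_le zero_le_one] at hs
        have hs' : s ∈ Icc (0 : ℝ) 1 := ⟨hs.1.le, hs.2⟩
        have hw := hW z hz s (hJ hs')
        have g0 := (hF.differentiableAt (show (z, s) ∈ S ×ˢ Ioo (-1 / 4 : ℝ) (5 / 4) from
          ⟨hz, hJ hs'⟩)).hasFDerivAt
        have g1 := HasFDerivAt.comp (f := fun z => (z, s)) z g0 (hasFDerivAt_prodMk_left z s)
        have g2 : HasFDerivAt (fun z => z - (s * u z) • e) (ContinuousLinearMap.id ℝ E -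
            (s • _root_.fderiv ℝ u z).smulRight e) z :=
          (hasFDerivAt_id z).sub
            (((hu.differentiableAt hz).hasFDerivAt.const_mul s).smul_const e)
        have g3 := (hh.differentiableAt hw).hasFDerivAt.comp z g2
        have g4 : (_root_.fderiv ℝ (fun x : E × ℝ => h (x.1 - (x.2 * u x.1) • e)) (z, s)).comp
            (ContinuousLinearMap.inl ℝ E ℝ) = _root_.fderiv ℝ h (z - (s * u z) • e) -
              (s * _root_.fderiv ℝ h (z - (s * u z) • e) e) • _root_.fderiv ℝ u z := by
          refine (g1.unique g3).trans ?_
          ext v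
          simp only [ContinuousLinearMap.comp_apply, sub_apply, smul_apply, smul_eq_mul,
            ContinuousLinearMap.smulRight_apply, ContinuousLinearMap.id_apply, map_sub, map_smul]
          ring
        rw [g4]
        exact norm_comp_sub_smul_sub_le he hℓ hℓe hε0 hε (hDh _ hw) (hDu z hz) hs'
    rw [e1, norm_smul, Real.norm_eq_abs, abs_div, abs_two, div_mul_eq_mul_div, div_le_iff₀ habs]
    simp only [sub_zero, abs_one, mul_one] at e2
    linarith
  · have hb0 : 0 ≤ β z := le_trans (by norm_num) (hβI z hz).1
    have h5 : ∫ s in (0 : ℝ)..1, h (z - (s * u z) • e) = lam / 2 * (u z * β z) := by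
      rw [← hmul z hz]
      rw [hη, ← mul_assoc, show lam / 2 * (2 / lam) = 1 by field_simp, one_mul]
    rw [h5, mul_pow, Real.sq_sqrt hb0]
    ring
  · simp [hz0]

end Fiber

/-! ### Critical graphs and the elimination of one variable. -/

section CriticalGraph

/-- `P` is an orthogonal projection, and `T` inverts `A` on its range. -/
structure IsPartialInverse {E : Type*} [NormedAddCommGroup E] [InnerProductSpace ℝ E]
    (A P T : E →L[ℝ] E) (σ : ℝ) : Prop where
  symm : ∀ x y, inner ℝ (P x) y = inner ℝ x (P y)
  idem : ∀ x, P (P x) = P x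
  left_inv : ∀ x, T (A x) = P x
  right_inv : ∀ x, A (T x) = P x
  proj_apply : ∀ x, P (T x) = T x
  norm_le : ‖T‖ ≤ σ⁻¹
  norm_compl_le : ‖ContinuousLinearMap.id ℝ E - P‖ ≤ 1

/-- `g z` is the point of `z + range P` where the `P`-part of the gradient field `G` vanishes. -/
structure IsCriticalGraph {E : Type*} [NormedAddCommGroup E] [InnerProductSpace ℝ E]
    (G : E → E) (P : E →L[ℝ] E) (R ε : ℝ) (g : E → E) : Prop where
  mapsTo : ∀ z ∈ ball (0 : E) (3 / 4 * R), g z ∈ ball (0 : E) R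
  compl_eq : ∀ z ∈ ball (0 : E) (3 / 4 * R), g z - P (g z) = z - P z
  crit : ∀ z ∈ ball (0 : E) (3 / 4 * R), P (G (g z)) = 0
  norm_fderiv_sub_le : ∀ z ∈ ball (0 : E) (3 / 4 * R),
    ‖fderiv ℝ g z - (ContinuousLinearMap.id ℝ E - P)‖ ≤ 2 * ε
  unique : ∀ x ∈ ball (0 : E) R, P (G x) = 0 →
    ∀ z ∈ ball (0 : E) (3 / 4 * R), z - P z = x - P x → g z = x

theorem CkBounded.exists_isCriticalGraph (m : ℕ) (C : ℝ) (hC : 1 ≤ C) : ∃ C' : ℝ, 0 ≤ C' ∧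
    ∀ {E : Type} [NormedAddCommGroup E] [InnerProductSpace ℝ E] [CompleteSpace E] {G : E → E}
      {A P T : E →L[ℝ] E} {R σ ε : ℝ}, 0 < R → R ≤ C → 0 < σ → σ⁻¹ ≤ C → 0 ≤ ε → ε ≤ 1 / 4 →
      IsPartialInverse A P T σ → CkBounded (m + 1) C G (ball 0 R) → G 0 = 0 →
      (∀ z ∈ ball (0 : E) R, ‖_root_.fderiv ℝ G z - A‖ ≤ σ * ε) →
      ∃ g : E → E, CkBounded (m + 1) C' g (ball 0 (3 / 4 * R)) ∧
        IsCriticalGraph G P R ε g := by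
  have hC0 : 0 ≤ C := zero_le_one.trans hC
  obtain ⟨C₁, hC₁, hinv⟩ := exists_inverse m (max 2 (C + C * C)) (by positivity)
  refine ⟨(m + 1).factorial * C₁ * max 1 C ^ (m + 1), by positivity, ?_⟩
  intro E _ _ _ G A P T R σ ε hR hRC hσ hσC hε0 hε hP hG hG0 hDG
  set Q : E →L[ℝ] E := ContinuousLinearMap.id ℝ E - P with hQ
  have hQ1 : ∀ x, ‖Q x‖ ≤ ‖x‖ := fun x => by
    simpa using Q.le_of_opNorm_le hP.norm_compl_le x
  -- Since `T A = P`, this is the identity to first order. As `P T = T`, the equation `Ψ x = Q z`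
  -- splits into `Q x = Q z` and `T (G x) = 0`, and the latter says `P (G x) = 0`. Hence `g = Γ ∘ Q`
  -- below.
  set Ψ : E → E := fun z => Q z + T (G z) with hΨ
  have cΨ : CkBounded (m + 1) (max 2 (C + C * C)) Ψ (ball 0 R) := by
    refine CkBounded.mono ((of_clm isOpen_ball Q (hP.norm_compl_le.trans hC) fun z hz => ?_).add
      (hG.clm T (hP.norm_le.trans hσC))) le_rfl (le_max_right _ _)
    exact (hQ1 z).trans ((mem_ball_zero_iff.1 hz).le.trans hRC)
  have hdΨ : ∀ z ∈ ball (0 : E) R, ‖_root_.fderiv ℝ Ψ z - ContinuousLinearMap.id ℝ E‖ ≤ ε := by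
    intro z hz
    have h1 : HasFDerivAt Ψ (Q + T.comp (_root_.fderiv ℝ G z)) z :=
      Q.hasFDerivAt.add (T.hasFDerivAt.comp z (hG.differentiableAt hz).hasFDerivAt)
    have h2 : Q + T.comp (_root_.fderiv ℝ G z) - ContinuousLinearMap.id ℝ E =
        T.comp (_root_.fderiv ℝ G z - A) := by
      ext v
      simp only [hQ, sub_apply, add_apply, ContinuousLinearMap.comp_apply, map_sub, hP.left_inv]
      abel
    rw [h1.fderiv, h2]
    calc _ ≤ ‖T‖ * ‖_root_.fderiv ℝ G z - A‖ := ContinuousLinearMap.opNorm_comp_le _ _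
      _ ≤ σ⁻¹ * (σ * ε) := by
        gcongr
        exacts [hP.norm_le, hDG z hz]
      _ = ε := by field_simp
  have hΨ0 : Ψ 0 = 0 := by simp [hΨ, hG0]
  obtain ⟨Γ, hΓ1, hΓ2, hΓ3, -, hΓ5, hΓ6⟩ := exists_inverse_of_norm_fderiv_sub_id_le hR hε0
    (by linarith) hΨ0 (Nat.le_add_left 1 m) cΨ.contDiffOn hdΨ
  -- Here `ε ≤ 1 / 4` fixes the radius `3 / 4 * R`.
  have hsub : ball (0 : E) (3 / 4 * R) ⊆ ball 0 ((1 - ε) * R) :=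
    ball_subset_ball (by nlinarith)
  have hΓd : ∀ w ∈ ball (0 : E) ((1 - ε) * R), DifferentiableAt ℝ Γ w := fun w hw =>
    (hΓ5.contDiffAt (isOpen_ball.mem_nhds hw)).differentiableAt
      (by exact_mod_cast Nat.succ_ne_zero m)
  have hΓn := fun w hw => norm_le_two_of_mul_eq_one (by linarith : ε ≤ 1 / 2)
    (hdΨ _ (hΓ1 w hw)) (hΓ6 w hw).1
  have cΓ : CkBounded (m + 1) C₁ Γ (ball 0 ((1 - ε) * R)) := by
    refine hinv cΨ isOpen_ball hΓ1 hΓd (fun w hw => ?_)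
      (fun w hw => (hΓn w hw).1.trans (le_max_left _ _)) hΓ6
    refine (mem_ball_zero_iff.1 (hΓ1 w hw)).le.trans (hRC.trans (le_max_of_le_right ?_))
    nlinarith
  have hQm : ∀ z ∈ ball (0 : E) (3 / 4 * R), Q z ∈ ball (0 : E) ((1 - ε) * R) := fun z hz =>
    hsub (mem_ball_zero_iff.2 ((hQ1 z).trans_lt (mem_ball_zero_iff.1 hz)))
  refine ⟨fun z => Γ (Q z), cΓ.comp hC₁ (of_clm isOpen_ball Q (hP.norm_compl_le.trans hC)
    fun z hz => (hQ1 z).trans ((mem_ball_zero_iff.1 hz).le.trans (by linarith))) hQm,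
    fun z hz => hΓ1 _ (hQm z hz), fun z hz => ?_, fun z hz => ?_, fun z hz => ?_,
    fun x hx hx0 z hz hzx => ?_⟩
  · have h1 := congrArg (fun x => x - P x) (hΓ2 _ (hQm z hz))
    simpa [hΨ, hQ, hP.idem, hP.proj_apply] using h1
  · have h1 := congrArg (fun x => A (P x)) (hΓ2 _ (hQm z hz))
    have h2 : A (T (G (Γ (Q z)))) = 0 := by
      simpa [hΨ, hQ, hP.idem, hP.proj_apply] using h1
    rwa [hP.right_inv] at h2
  · have h1 : HasFDerivAt (fun z => Γ (Q z)) ((_root_.fderiv ℝ Γ (Q z)).comp Q) z :=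
      (hΓd _ (hQm z hz)).hasFDerivAt.comp z Q.hasFDerivAt
    have h2 : (_root_.fderiv ℝ Γ (Q z)).comp Q - Q =
        (_root_.fderiv ℝ Γ (Q z) - ContinuousLinearMap.id ℝ E).comp Q := by
      ext v; simp
    rw [h1.fderiv, h2]
    refine (ContinuousLinearMap.opNorm_comp_le _ _).trans ?_
    exact (mul_le_of_le_one_right (norm_nonneg _) hP.norm_compl_le).trans (hΓn _ (hQm z hz)).2
  · have h1 : T (G x) = 0 := by
      rw [← hP.proj_apply, ← hP.left_inv, hP.right_inv, hx0, map_zero]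
    have h2 : Ψ x = Q z := by
      simp [hΨ, h1, hQ, hzx]
    change Γ (Q z) = x
    rw [← h2, hΓ3 x hx]

variable {E : Type*} [NormedAddCommGroup E] [InnerProductSpace ℝ E]

namespace IsCriticalGraph

variable {G : E → E} {P : E →L[ℝ] E} {R ε : ℝ} {g : E → E}

theorem map_zero (hg : IsCriticalGraph G P R ε g) (hR : 0 < R) (hG0 : G 0 = 0) : g 0 = 0 :=
  hg.unique 0 (mem_ball_self hR) (by simp [hG0]) 0 (mem_ball_self (by linarith)) rfl

/-- Along the critical graph the differential of `f` is given by the gradient at the critical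
point. -/
theorem hasFDerivAt_comp (hg : IsCriticalGraph G P R ε g)
    (hsymm : ∀ x y, inner ℝ (P x) y = inner ℝ x (P y)) {f : E → ℝ}
    (hf : ∀ z ∈ ball (0 : E) R, HasFDerivAt f (innerSL ℝ (G z)) z) {z : E}
    (hz : z ∈ ball (0 : E) (3 / 4 * R)) (hd : DifferentiableAt ℝ g z) :
    HasFDerivAt (fun z => f (g z)) (innerSL ℝ (G (g z))) z := by
  have h1 := (hf _ (hg.mapsTo z hz)).comp z hd.hasFDerivAt
  refine HasFDerivAt.congr_fderiv h1 ?_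
  -- Differentiating `compl_eq` gives `(1 - P) Dg = 1 - P`, while `G (g z)` is orthogonal to the
  -- range of `P`. So `⟪G (g z), Dg v⟫ = ⟪G (g z), v⟫`, and no derivative of `g` survives.
  have h2 : HasFDerivAt (fun z => g z - P (g z)) (fderiv ℝ g z - P.comp (fderiv ℝ g z)) z :=
    hd.hasFDerivAt.sub (P.hasFDerivAt.comp z hd.hasFDerivAt)
  have h3 : HasFDerivAt (fun z => g z - P (g z)) (ContinuousLinearMap.id ℝ E - P) z := by
    refine ((hasFDerivAt_id z).sub P.hasFDerivAt).congr_of_eventuallyEq ?_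
    exact Filter.eventuallyEq_of_mem (isOpen_ball.mem_nhds hz) hg.compl_eq
  have h4 := h2.unique h3
  have hP : ∀ x, inner ℝ (G (g z)) (P x) = 0 := fun x => by
    rw [← hsymm, hg.crit z hz, inner_zero_left]
  ext v
  have h5 := congrArg (fun L : E →L[ℝ] E => inner ℝ (G (g z)) (L v)) h4
  simp only [sub_apply, ContinuousLinearMap.comp_apply, ContinuousLinearMap.id_apply, inner_sub_right, hP,
    sub_zero] at h5
  simpa using h5

end IsCriticalGraph

/-- One more variable is eliminated: passing from the critical graph for `P'` to the one for
`P = P' + ⟪e, ·⟫ e` changes `f` by a square. -/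
theorem CkBounded.exists_elimination (m : ℕ) (C : ℝ) (hC : 1 ≤ C) : ∃ C' : ℝ, 0 ≤ C' ∧
    ∀ {E : Type} [NormedAddCommGroup E] [InnerProductSpace ℝ E] {f : E → ℝ} {G : E → E}
      {A P P' : E →L[ℝ] E} {R σ ε lam : ℝ} {e : E} {g g' : E → E},
      0 < R → R ≤ C → 0 < σ → σ⁻¹ ≤ C → σ ≤ |lam| → 0 ≤ ε → ε ≤ 1 / 60 → ‖e‖ = 1 →
      (∀ x, P x = P' x + inner ℝ e x • e) → P' e = 0 → (∀ x, inner ℝ e (A x) = lam * inner ℝ e x) →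
      (∀ x y, inner ℝ (P' x) y = inner ℝ x (P' y)) →
      ‖ContinuousLinearMap.id ℝ E - P'‖ ≤ 1 → (∀ x, P' (P' x) = P' x) →
      (∀ z ∈ ball (0 : E) R, HasFDerivAt f (innerSL ℝ (G z)) z) →
      CkBounded (m + 2) C G (ball 0 R) → G 0 = 0 →
      (∀ z ∈ ball (0 : E) R, ‖_root_.fderiv ℝ G z - A‖ ≤ σ * ε) →
      CkBounded (m + 2) C g (ball 0 (3 / 4 * R)) → IsCriticalGraph G P R ε g →
      CkBounded (m + 2) C g' (ball 0 (3 / 4 * R)) → IsCriticalGraph G P' R ε g' →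
      ∃ ξ : E → ℝ, CkBounded (m + 2) C' ξ (ball 0 (R / 4)) ∧
        (∀ z ∈ ball (0 : E) (R / 4), ‖_root_.fderiv ℝ ξ z - innerSL ℝ e‖ ≤ 30 * ε) ∧
        (∀ z ∈ ball (0 : E) (R / 4), f (g' z) - f (g z) = lam / 2 * ξ z ^ 2) ∧ ξ 0 = 0 := by
  have hC0 : 0 ≤ C := zero_le_one.trans hC
  set D : ℝ := max (1 * (C + C)) (1 * ((m + 2).factorial * C * max 1 C ^ (m + 2))) with hD
  have hCD : C ≤ D := le_max_of_le_left (by linarith)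
  obtain ⟨C', hC', hfib⟩ := exists_fiber m D (hC.trans hCD)
  refine ⟨C', hC', ?_⟩
  intro E _ _ f G A P P' R σ ε lam e g g' hR hRC hσ hσC hlam hε0 hε he hPP' hP'e heA hsymm hQ'
    hidem hf hG hG0 hDG hg hgc hg' hgc'
  have hsub : ball (0 : E) (R / 4) ⊆ ball 0 (3 / 4 * R) := ball_subset_ball (by linarith)
  have hℓ : ‖innerSL ℝ e‖ ≤ 1 := by rw [innerSL_apply_norm, he]
  have hℓe : innerSL ℝ e e = 1 := by
    rw [innerSL_apply_apply, real_inner_self_eq_norm_sq, he, one_pow]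
  have heP' : ∀ x, inner ℝ e (P' x) = 0 := fun x => by
    rw [← hsymm, hP'e, inner_zero_left]
  have heP : ∀ x, inner ℝ e (P x) = inner ℝ e x := fun x => by
    rw [hPP', inner_add_right, heP', inner_smul_right, real_inner_self_eq_norm_sq, he]
    ring
  have hlam0 : 0 < |lam| := hσ.trans_le hlam
  -- `u` is the offset along `e` from the new critical point, and `h` is the slope of `f ∘ g'` along
  -- `e`.
  set u : E → ℝ := fun z => innerSL ℝ e (z - g z) with hu
  set h : E → ℝ := fun w => innerSL ℝ e (G (g' w)) with hh
  have cid : CkBounded (m + 2) C (fun z : E => z) (ball 0 (R / 4)) :=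
    of_clm isOpen_ball (ContinuousLinearMap.id ℝ E)
      (ContinuousLinearMap.norm_id_le.trans hC) fun z hz =>
      (mem_ball_zero_iff.1 hz).le.trans (by linarith)
  have cu : CkBounded (m + 2) D u (ball 0 (R / 4)) :=
    ((cid.sub (hg.mono_set isOpen_ball hsub)).clm _ hℓ).mono le_rfl (le_max_left _ _)
  have ch : CkBounded (m + 2) D h (ball 0 (3 / 4 * R)) :=
    ((hG.comp hC0 hg' hgc'.mapsTo).clm _ hℓ).mono le_rfl (le_max_right _ _)
  have hDu : ∀ z ∈ ball (0 : E) (R / 4), ‖_root_.fderiv ℝ u z - innerSL ℝ e‖ ≤ 2 * ε := by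
    intro z hz
    have h1 : HasFDerivAt u ((innerSL ℝ e).comp
        (ContinuousLinearMap.id ℝ E - _root_.fderiv ℝ g z)) z :=
      (innerSL ℝ e).hasFDerivAt.comp z
        ((hasFDerivAt_id z).sub (hg.differentiableAt (hsub hz)).hasFDerivAt)
    have h2 : (innerSL ℝ e).comp (ContinuousLinearMap.id ℝ E - _root_.fderiv ℝ g z) -
        innerSL ℝ e = -(innerSL ℝ e).comp
          (_root_.fderiv ℝ g z - (ContinuousLinearMap.id ℝ E - P)) := by
      ext v
      simp [heP]
    rw [h1.fderiv, h2, norm_neg]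
    refine (ContinuousLinearMap.opNorm_comp_le _ _).trans ?_
    exact (mul_le_of_le_one_left (norm_nonneg _) hℓ).trans (hgc.norm_fderiv_sub_le z (hsub hz))
  have hDh : ∀ w ∈ ball (0 : E) (3 / 4 * R),
      ‖_root_.fderiv ℝ h w - lam • innerSL ℝ e‖ ≤ 4 * ε * |lam| := by
    intro w hw
    have h1 : HasFDerivAt h ((innerSL ℝ e).comp
        ((_root_.fderiv ℝ G (g' w)).comp (_root_.fderiv ℝ g' w))) w :=
      (innerSL ℝ e).hasFDerivAt.comp w ((hG.differentiableAt (hgc'.mapsTo w hw)).hasFDerivAt.comp w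
        (hg'.differentiableAt hw).hasFDerivAt)
    set B := _root_.fderiv ℝ G (g' w) - A with hB
    set N := _root_.fderiv ℝ g' w - (ContinuousLinearMap.id ℝ E - P') with hN
    have hBn : ‖B‖ ≤ σ * ε := hDG _ (hgc'.mapsTo w hw)
    have hNn : ‖N‖ ≤ 2 * ε := hgc'.norm_fderiv_sub_le w hw
    -- `e` is an eigenvector of `A` orthogonal to the range of `P'`, so the main term is exactly
    -- `lam ⟪e, ·⟫`. The errors are `2 σ ε` and `2 |lam| ε`, with `σ ≤ |lam|`.
    have h2 : (innerSL ℝ e).comp ((_root_.fderiv ℝ G (g' w)).comp (_root_.fderiv ℝ g' w)) -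
        lam • innerSL ℝ e = (innerSL ℝ e).comp (B.comp (_root_.fderiv ℝ g' w)) +
          lam • (innerSL ℝ e).comp N := by
      ext v
      simp only [hB, hN, sub_apply, add_apply, smul_apply, ContinuousLinearMap.comp_apply,
        innerSL_apply_apply, inner_sub_right, heA, ContinuousLinearMap.id_apply, heP', smul_eq_mul]
      ring
    have hg'n : ‖_root_.fderiv ℝ g' w‖ ≤ 2 := by
      have := norm_add_le_of_le hNn hQ'
      rw [hN, sub_add_cancel] at this
      linarith
    rw [h1.fderiv, h2]
    have h3 : ‖(innerSL ℝ e).comp (B.comp (_root_.fderiv ℝ g' w))‖ ≤ 1 * (σ * ε * 2) := by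
      refine (ContinuousLinearMap.opNorm_comp_le _ _).trans ?_
      gcongr
      refine (ContinuousLinearMap.opNorm_comp_le _ _).trans ?_
      gcongr
    have h4 : ‖lam • (innerSL ℝ e).comp N‖ ≤ |lam| * (1 * (2 * ε)) := by
      rw [norm_smul, Real.norm_eq_abs]
      gcongr
      refine (ContinuousLinearMap.opNorm_comp_le _ _).trans ?_
      gcongr
    refine (norm_add_le_of_le h3 h4).trans ?_
    nlinarith
  have hg0 : g 0 = 0 := hgc.map_zero hR hG0
  have hu0 : u 0 = 0 := by simp [hu, hg0]
  -- The constant is `1 + 2 / 60`. Since `1 + (5 / 4) (31 / 30) < 3`, the segments starting in the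
  -- ball of radius `R / 4` stay in the one of radius `3 / 4 * R`.
  have hub : ∀ z ∈ ball (0 : E) (R / 4), |u z| ≤ 31 / 30 * ‖z‖ := by
    intro z hz
    have := (convex_ball (0 : E) (R / 4)).norm_image_sub_le_of_norm_fderiv_le (𝕜 := ℝ) (f := u)
      (C := 31 / 30) (fun x hx => cu.differentiableAt hx) (fun x hx => by
        have := norm_add_le_of_le (hDu x hx) hℓ
        rw [sub_add_cancel] at this
        linarith) (mem_ball_self (by linarith)) hz
    simpa [hu0] using this
  have hW : ∀ z ∈ ball (0 : E) (R / 4), ∀ s ∈ Ioo (-1 / 4 : ℝ) (5 / 4),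
      z - (s * u z) • e ∈ ball (0 : E) (3 / 4 * R) := by
    intro z hz s hs
    rw [mem_ball_zero_iff]
    have h1 : ‖(s * u z) • e‖ ≤ 5 / 4 * (31 / 30 * ‖z‖) := by
      rw [norm_smul, he, mul_one, Real.norm_eq_abs, abs_mul]
      have : |s| ≤ 5 / 4 := abs_le.2 ⟨by linarith [hs.1], hs.2.le⟩
      gcongr
      exact hub z hz
    have h2 := norm_sub_le_of_le le_rfl h1 (a₁ := z)
    have h3 := mem_ball_zero_iff.1 hz
    linarith
  have hW1 : ∀ z ∈ ball (0 : E) (R / 4), z - u z • e ∈ ball (0 : E) (3 / 4 * R) := fun z hz => by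
    simpa using hW z hz 1 (by norm_num)
  -- `g z` is also critical for the smaller projection `P'`, and it lies in the `P'`-slice through
  -- `z - u e`; uniqueness on that slice applies.
  have hgg' : ∀ z ∈ ball (0 : E) (R / 4), g' (z - u z • e) = g z := by
    intro z hz
    refine hgc'.unique _ (hgc.mapsTo z (hsub hz)) ?_ _ (hW1 z hz) ?_
    · have h1 := congrArg P' (hgc.crit z (hsub hz))
      rw [hPP', map_add, hidem, map_smul, hP'e, smul_zero, add_zero, _root_.map_zero] at h1
      exact h1
    · have h1 := hgc.compl_eq z (hsub hz)
      rw [hPP', hPP'] at h1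
      simp only [map_sub, map_smul, hP'e, smul_zero, sub_zero, hu, innerSL_apply_apply,
        sub_smul]
      have h2 : g z - P' (g z) = (g z - (P' (g z) + inner ℝ e (g z) • e)) +
        inner ℝ e (g z) • e := by abel
      rw [h2, h1]
      abel
  have hzero : ∀ z ∈ ball (0 : E) (R / 4), h (z - u z • e) = 0 := fun z hz => by
    simp only [hh, hgg' z hz, innerSL_apply_apply]
    rw [← heP, hgc.crit z (hsub hz), inner_zero_right]
  obtain ⟨ξ, h1, h2, h3, h4⟩ := hfib (S := ball 0 (R / 4)) (W := ball 0 (3 / 4 * R)) (h := h)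
    (u := u) (e := e) (ℓ := innerSL ℝ e) (lam := lam) (ε := ε) he.le hℓ hℓe (abs_pos.1 hlam0)
    ((inv_anti₀ hσ hlam).trans (hσC.trans hCD)) hε0 hε
    (fun z hz => (cid.norm_apply_le hz).trans hCD) ch cu hW hzero hDh hDu
  refine ⟨ξ, h1, h2, fun z hz => ?_, h4 0 (mem_ball_self (by linarith)) hu0⟩
  rw [h3 z hz, ← hgg' z hz]
  have hJ : Icc (0 : ℝ) 1 ⊆ Ioo (-1 / 4 : ℝ) (5 / 4) := fun s hs =>
    ⟨by linarith [hs.1], by linarith [hs.2]⟩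
  -- This path of values runs from `f (g' z)` to `f (g z)`, and the envelope identity gives its
  -- speed without derivatives of `g'`.
  have hd : ∀ s ∈ uIcc (0 : ℝ) 1, HasDerivAt (fun s : ℝ => f (g' (z - (s * u z) • e)))
      (-(u z * h (z - (s * u z) • e))) s := by
    intro s hs
    rw [uIcc_of_le zero_le_one] at hs
    have hw := hW z hz s (hJ hs)
    have d1 : HasDerivAt (fun s : ℝ => z - (s * u z) • e) (-(u z • e)) s := by
      simpa using (((hasDerivAt_id s).mul_const (u z)).smul_const e).const_sub z
    have d2 := (hgc'.hasFDerivAt_comp hsymm hf hw (hg'.differentiableAt hw)).comp_hasDerivAt s d1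
    refine HasDerivAt.congr_deriv d2 ?_
    simp [hh, inner_smul_right, real_inner_comm e]
  have hcont : ContinuousOn (fun s : ℝ => h (z - (s * u z) • e)) (uIcc 0 1) := by
    rw [uIcc_of_le zero_le_one]
    exact ch.contDiffOn.continuousOn.comp (by fun_prop) fun s hs => hW z hz s (hJ hs)
  have key := intervalIntegral.integral_eq_sub_of_hasDerivAt hd
    (hcont.const_smul (u z)).neg.intervalIntegrable
  rw [intervalIntegral.integral_neg, intervalIntegral.integral_const_mul] at key
  simp only [one_mul, zero_mul, zero_smul, sub_zero] at key
  linarith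

end CriticalGraph

/-! ### Diagonal operators and coordinate projections. -/

section Coordinates

/-- The diagonal operator with entries `d`. -/
noncomputable def diagCLM {n : ℕ} (d : Fin n → ℝ) : Eucl n →L[ℝ] Eucl n :=
  LinearMap.toContinuousLinearMap
    { toFun := fun z => WithLp.toLp 2 fun i => d i * z i
      map_add' := fun x y => by ext i; simp [mul_add]
      map_smul' := fun c x => by ext i; simp [mul_left_comm] }

@[simp]
theorem diagCLM_apply {n : ℕ} (d : Fin n → ℝ) (z : Eucl n) (i : Fin n) :
    diagCLM d z i = d i * z i := rfl

theorem norm_diagCLM_apply_le {n : ℕ} {d : Fin n → ℝ} {c : ℝ} (hc : 0 ≤ c) (hd : ∀ i, |d i| ≤ c)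
    (z : Eucl n) : ‖diagCLM d z‖ ≤ c * ‖z‖ := by
  rw [← sq_le_sq₀ (norm_nonneg _) (by positivity), mul_pow, EuclideanSpace.norm_sq_eq,
    EuclideanSpace.norm_sq_eq, Finset.mul_sum]
  refine Finset.sum_le_sum fun i _ => ?_
  rw [diagCLM_apply, norm_mul, mul_pow, Real.norm_eq_abs]
  gcongr
  exact hd i

theorem norm_diagCLM_le {n : ℕ} {d : Fin n → ℝ} {c : ℝ} (hc : 0 ≤ c) (hd : ∀ i, |d i| ≤ c) :
    ‖diagCLM d‖ ≤ c :=
  ContinuousLinearMap.opNorm_le_bound _ hc (norm_diagCLM_apply_le hc hd)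

/-- The inclusion `y ↦ (0, y)`. -/
noncomputable def inrCLM (p q : ℕ) : Eucl q →L[ℝ] Eucl (p + q) :=
  LinearMap.toContinuousLinearMap
    { toFun := fun y => WithLp.toLp 2 (Fin.append (fun _ => 0) y)
      map_add' := fun x y => by
        ext i; refine Fin.addCases (fun i => ?_) (fun i => ?_) i <;> simp
      map_smul' := fun c x => by
        ext i; refine Fin.addCases (fun i => ?_) (fun i => ?_) i <;> simp }

@[simp]
theorem inrCLM_apply_castAdd {p q : ℕ} (y : Eucl q) (i : Fin p) :
    inrCLM p q y (Fin.castAdd q i) = 0 := by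
  simp [inrCLM]

@[simp]
theorem inrCLM_apply_natAdd {p q : ℕ} (y : Eucl q) (j : Fin q) :
    inrCLM p q y (Fin.natAdd p j) = y j := by
  simp [inrCLM]

theorem norm_inrCLM_apply {p q : ℕ} (y : Eucl q) : ‖inrCLM p q y‖ = ‖y‖ := by
  rw [← sq_eq_sq₀ (norm_nonneg _) (norm_nonneg _), EuclideanSpace.norm_sq_eq,
    EuclideanSpace.norm_sq_eq, Fin.sum_univ_add]
  simp

/-- The projection onto the first `i` coordinates. -/
noncomputable def headProj (n i : ℕ) : Eucl n →L[ℝ] Eucl n := diagCLM fun j => if (j : ℕ) < i then 1 else 0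

/-- The inverse of the diagonal operator with entries `d` on the first `i` coordinates. -/
noncomputable def headInv {n : ℕ} (d : Fin n → ℝ) (i : ℕ) : Eucl n →L[ℝ] Eucl n :=
  diagCLM fun j => if (j : ℕ) < i then (d j)⁻¹ else 0

theorem headProj_apply {n i : ℕ} (z : Eucl n) (j : Fin n) :
    headProj n i z j = if (j : ℕ) < i then z j else 0 := by
  simp [headProj]

theorem isPartialInverse_headProj {n i : ℕ} {d : Fin n → ℝ} {σ : ℝ} (hσ : 0 < σ)
    (hd : ∀ j : Fin n, (j : ℕ) < i → σ ≤ |d j|) :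
    IsPartialInverse (diagCLM d) (headProj n i) (headInv d i) σ := by
  have hd0 : ∀ j : Fin n, (j : ℕ) < i → d j ≠ 0 := fun j hj =>
    abs_pos.1 (hσ.trans_le (hd j hj))
  refine ⟨fun x y => ?_, fun x => ?_, fun x => ?_, fun x => ?_, fun x => ?_, ?_, ?_⟩
  · simp only [PiLp.inner_apply, headProj_apply]
    refine Finset.sum_congr rfl fun j _ => ?_
    split_ifs <;> simp
  · ext j
    simp only [headProj_apply]
    split_ifs <;> rfl
  · ext j
    simp only [headProj_apply, headInv, diagCLM_apply]
    split_ifs with h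
    · field_simp [hd0 j h]
    · simp
  · ext j
    simp only [headProj_apply, headInv, diagCLM_apply]
    split_ifs with h
    · field_simp [hd0 j h]
    · simp
  · ext j
    simp only [headProj_apply, headInv, diagCLM_apply]
    split_ifs <;> simp
  · refine norm_diagCLM_le (by positivity) fun j => ?_
    split_ifs with h
    · rw [abs_inv]
      exact inv_anti₀ hσ (hd j h)
    · simpa using hσ.le
  · refine ContinuousLinearMap.opNorm_le_bound _ zero_le_one fun z => ?_
    have : (ContinuousLinearMap.id ℝ (Eucl n) - headProj n i) z =
        diagCLM (fun j => if (j : ℕ) < i then 0 else 1) z := by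
      ext j
      simp only [sub_apply, ContinuousLinearMap.id_apply, PiLp.sub_apply, headProj_apply,
        diagCLM_apply]
      split_ifs <;> simp
    rw [this]
    refine norm_diagCLM_apply_le zero_le_one (fun j => ?_) z
    split_ifs <;> simp

theorem headProj_zero (n : ℕ) (z : Eucl n) : headProj n 0 z = 0 := by
  ext j
  simp [headProj_apply]

theorem headProj_succ {n : ℕ} (i : Fin n) (z : Eucl n) : headProj n (i + 1) z =
    headProj n i z + inner ℝ (EuclideanSpace.single i (1 : ℝ)) z • EuclideanSpace.single i 1 := by
  ext j
  simp only [headProj_apply, PiLp.add_apply, PiLp.smul_apply, EuclideanSpace.inner_single_left,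
    smul_eq_mul, PiLp.single_apply]
  rcases lt_trichotomy j i with h | h | h
  · have h' : (j : ℕ) < i := h
    rw [if_pos (by omega), if_pos h', if_neg (ne_of_lt h)]
    simp
  · subst h
    simp
  · have h' : (i : ℕ) < j := h
    rw [if_neg (by omega), if_neg (by omega), if_neg (ne_of_gt h)]
    simp

theorem sub_headProj_eq_inrCLM {p q : ℕ} (z : Eucl (p + q)) :
    z - headProj (p + q) p z = inrCLM p q (sndPart z) := by
  ext j
  refine Fin.addCases (fun i => ?_) (fun i => ?_) j
  · simp [headProj_apply]
  · simp [headProj_apply, sndPart]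

end Coordinates

/-! ### The normal form at a diagonal Hessian. -/

section NormalForm

theorem sum_smul_single_castAdd {p q : ℕ} (a : Fin p → ℝ) (k : Fin p) :
    (∑ i, a i • (EuclideanSpace.single (Fin.castAdd q i) 1 : Eucl (p + q))) (Fin.castAdd q k) =
      a k := by
  simp [Pi.single_apply, eq_comm (a := k)]

theorem sum_smul_single_natAdd {p q : ℕ} (a : Fin p → ℝ) (k : Fin q) :
    (∑ i, a i • (EuclideanSpace.single (Fin.castAdd q i) 1 : Eucl (p + q))) (Fin.natAdd p k) =
      0 := by
  have : ∀ i : Fin p, Fin.natAdd p k ≠ Fin.castAdd q i := fun i h => by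
    have := congrArg Fin.val h
    simp at this
    omega
  simp [this]

/-- The critical value as a function of the remaining variables. -/
theorem exists_critical_value {p q m : ℕ} {f : Eucl (p + q) → ℝ} {G g : Eucl (p + q) → Eucl (p + q)}
    {d : Fin (p + q) → ℝ} {C R ε : ℝ} (hR : 0 < R) (hd : ∀ j, d (Fin.natAdd p j) = 0)
    (hf : ∀ z ∈ ball (0 : Eucl (p + q)) R, HasFDerivAt f (innerSL ℝ (G z)) z)
    (hG : ContDiffOn ℝ (m + 1 : ℕ) G (ball 0 R)) (hG0 : G 0 = 0)
    (hDG0 : fderiv ℝ G 0 = diagCLM d)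
    (hsymm : ∀ x y : Eucl (p + q),
      inner ℝ (headProj (p + q) p x) y = inner ℝ x (headProj (p + q) p y))
    (hg : CkBounded (m + 1) C g (ball 0 (3 / 4 * R)))
    (hgc : IsCriticalGraph G (headProj (p + q) p) R ε g) :
    ContDiffOn ℝ (m + 2 : ℕ) (fun y => f (g (inrCLM p q y))) (ball 0 (3 / 4 * R)) ∧
      f (g (inrCLM p q 0)) = f 0 ∧ fderiv ℝ (fun y => f (g (inrCLM p q y))) 0 = 0 ∧
      iteratedFDeriv ℝ 2 (fun y => f (g (inrCLM p q y))) 0 = 0 := by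
  have hmaps : ∀ y ∈ ball (0 : Eucl q) (3 / 4 * R),
      inrCLM p q y ∈ ball (0 : Eucl (p + q)) (3 / 4 * R) := fun y hy => by
    rw [mem_ball_zero_iff, norm_inrCLM_apply]
    exact mem_ball_zero_iff.1 hy
  have h0 : (0 : Eucl q) ∈ ball (0 : Eucl q) (3 / 4 * R) := mem_ball_self (by linarith)
  have h0' : (0 : Eucl (p + q)) ∈ ball (0 : Eucl (p + q)) (3 / 4 * R) :=
    mem_ball_self (by linarith)
  have hg0 : g 0 = 0 := hgc.map_zero hR hG0
  have hd1 : ∀ z ∈ ball (0 : Eucl (p + q)) (3 / 4 * R),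
      HasFDerivAt (fun z => f (g z)) (innerSL ℝ (G (g z))) z := fun z hz =>
    hgc.hasFDerivAt_comp hsymm hf hz (hg.differentiableAt hz)
  have hGg : ContDiffOn ℝ (m + 1 : ℕ) (fun z => innerSL ℝ (G (g z))) (ball 0 (3 / 4 * R)) :=
    (innerSL ℝ).contDiff.comp_contDiffOn (hG.comp hg.contDiffOn hgc.mapsTo)
  -- One order more than `g` itself: the differential is `G ∘ g`, already of class `C^{m+1}`.
  have hfg : ContDiffOn ℝ (m + 2 : ℕ) (fun z => f (g z)) (ball 0 (3 / 4 * R)) := by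
    rw [show ((m + 2 : ℕ) : WithTop ℕ∞) = ((m + 1 : ℕ) : WithTop ℕ∞) + 1 by norm_cast,
      contDiffOn_succ_iff_fderiv_of_isOpen isOpen_ball]
    exact ⟨fun z hz => (hd1 z hz).differentiableAt.differentiableWithinAt, by simp,
      hGg.congr fun z hz => (hd1 z hz).fderiv⟩
  have hd2 : ∀ y ∈ ball (0 : Eucl q) (3 / 4 * R), HasFDerivAt (fun y => f (g (inrCLM p q y)))
      ((innerSL ℝ (G (g (inrCLM p q y)))).comp (inrCLM p q)) y := fun y hy =>
    (hd1 _ (hmaps y hy)).comp y (inrCLM p q).hasFDerivAt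
  refine ⟨hfg.comp (inrCLM p q).contDiff.contDiffOn hmaps, by simp [hg0], ?_, ?_⟩
  · rw [(hd2 0 h0).fderiv]
    simp [hg0, hG0]
  · rw [← norm_eq_zero, ← norm_iteratedFDeriv_fderiv, norm_iteratedFDeriv_one, norm_eq_zero]
    have e1 : fderiv ℝ (fun y => f (g (inrCLM p q y))) =ᶠ[nhds 0]
        fun y => (innerSL ℝ (G (g (inrCLM p q y)))).comp (inrCLM p q) :=
      Filter.eventuallyEq_of_mem (isOpen_ball.mem_nhds h0) fun y hy => (hd2 y hy).fderiv
    have hGd : HasFDerivAt G (diagCLM d) (g (inrCLM p q 0)) := by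
      rw [_root_.map_zero, hg0, ← hDG0]
      exact ((hG.contDiffAt (isOpen_ball.mem_nhds (mem_ball_self hR))).differentiableAt
        (by exact_mod_cast Nat.succ_ne_zero m)).hasFDerivAt
    have hgd : HasFDerivAt (fun y => g (inrCLM p q y)) ((fderiv ℝ g 0).comp (inrCLM p q)) 0 := by
      have := (hg.differentiableAt h0').hasFDerivAt
      rw [← _root_.map_zero (inrCLM p q)] at this
      have h2 := this.comp (0 : Eucl q) (inrCLM p q).hasFDerivAt
      rwa [_root_.map_zero] at h2
    set Λ : Eucl (p + q) →L[ℝ] (Eucl q →L[ℝ] ℝ) :=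
      ((ContinuousLinearMap.compL ℝ (Eucl q) (Eucl (p + q)) ℝ).flip (inrCLM p q)).comp
        (innerSL ℝ : Eucl (p + q) →L[ℝ] Eucl (p + q) →L[ℝ] ℝ) with hΛ
    have e2 := Λ.hasFDerivAt.comp (0 : Eucl q) (HasFDerivAt.comp (0 : Eucl q) hGd hgd)
    rw [(e2.congr_of_eventuallyEq e1).fderiv]
    -- `Λ` tests only against the last `q` coordinates, on which `d` vanishes; hence the second
    -- derivative is zero.
    have hΛd : ∀ x, Λ (diagCLM d x) = 0 := fun x => by
      ext y
      simp [hΛ, PiLp.inner_apply, Fin.sum_univ_add, hd]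
    ext y : 1
    simp [hΛd]

/-- The normal form for a function whose Hessian at the critical point `0` is diagonal, with
uniform bounds. -/
theorem CkBounded.exists_normal_form (m p : ℕ) (C : ℝ) (hC : 1 ≤ C) : ∃ C' : ℝ, 0 ≤ C' ∧
    ∀ {q : ℕ} {f : Eucl (p + q) → ℝ} {G : Eucl (p + q) → Eucl (p + q)} {d : Fin (p + q) → ℝ}
      {R σ ε : ℝ}, 0 < R → R ≤ C → 0 < σ → σ⁻¹ ≤ C → 0 ≤ ε → ε ≤ 1 / 4 → (0 < p → ε ≤ 1 / 60) →
      p * (30 * ε) ≤ 1 / 2 → (∀ i, σ ≤ |d (Fin.castAdd q i)|) → (∀ j, d (Fin.natAdd p j) = 0) →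
      (∀ z ∈ ball (0 : Eucl (p + q)) R, HasFDerivAt f (innerSL ℝ (G z)) z) →
      CkBounded (m + 2) C G (ball 0 R) → G 0 = 0 → _root_.fderiv ℝ G 0 = diagCLM d →
      (∀ z ∈ ball (0 : Eucl (p + q)) R, ‖_root_.fderiv ℝ G z - diagCLM d‖ ≤ σ * ε) →
      ∃ (Γ Ψ : Eucl (p + q) → Eucl (p + q)) (ν : Eucl q → ℝ),
        CkBounded (m + 2) C' Γ (ball 0 (R / 8)) ∧ MapsTo Γ (ball 0 (R / 8)) (ball 0 (R / 4)) ∧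
        ContDiffOn ℝ (m + 2 : ℕ) Ψ (ball 0 (R / 4)) ∧
        (∀ w ∈ ball (0 : Eucl (p + q)) (R / 8), Ψ (Γ w) = w) ∧
        (∀ z ∈ ball (0 : Eucl (p + q)) (R / 4), Γ (Ψ z) = z) ∧ Γ 0 = 0 ∧
        (∀ w ∈ ball (0 : Eucl (p + q)) (R / 8), ‖_root_.fderiv ℝ Γ w‖ ≤ 2) ∧
        (∀ w ∈ ball (0 : Eucl (p + q)) (R / 8), f (Γ w) = ν (sndPart w) +
          ∑ i, d (Fin.castAdd q i) / 2 * w (Fin.castAdd q i) ^ 2) ∧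
        ContDiffOn ℝ (m + 3 : ℕ) ν (ball 0 (R / 8)) ∧ ν 0 = f 0 ∧ _root_.fderiv ℝ ν 0 = 0 ∧
        iteratedFDeriv ℝ 2 ν 0 = 0 := by
  have hC0 : 0 ≤ C := zero_le_one.trans hC
  obtain ⟨C₁, hC₁, hgraph⟩ := exists_isCriticalGraph (m + 1) C hC
  set D : ℝ := max C C₁ with hD
  have hCD : C ≤ D := le_max_left _ _
  obtain ⟨C₂, hC₂, helim⟩ := exists_elimination m D (hC.trans hCD)
  set B : ℝ := max 2 (C + p * (1 * C₂)) with hB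
  obtain ⟨C', hC', hinv⟩ := exists_inverse (m + 1) (max B C) (le_max_of_le_right hC0)
  refine ⟨C', hC', ?_⟩
  intro q f G d R σ ε hR hRC hσ hσC hε0 hε' hε hpε hd hd0 hf hG hG0 hDG0 hDG
  have hP : ∀ i ≤ p, IsPartialInverse (diagCLM d) (headProj (p + q) i) (headInv d i) σ := by
    refine fun i hi => isPartialInverse_headProj hσ fun j hj => ?_
    have := hd ⟨j, by omega⟩
    exact this
  have hg : ∀ i : ℕ, ∃ g : Eucl (p + q) → Eucl (p + q), i ≤ p →
      CkBounded (m + 2) D g (ball 0 (3 / 4 * R)) ∧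
        IsCriticalGraph G (headProj (p + q) i) R ε g := by
    intro i
    by_cases hi : i ≤ p
    · obtain ⟨g, h1, h2⟩ := hgraph hR hRC hσ hσC hε0 hε' (hP i hi) hG hG0 hDG
      exact ⟨g, fun _ => ⟨h1.mono le_rfl (le_max_right _ _), h2⟩⟩
    · exact ⟨id, fun h => absurd h hi⟩
  choose g hg using hg
  set e : Fin p → Eucl (p + q) := fun i => EuclideanSpace.single (Fin.castAdd q i) 1 with he
  have hen : ∀ i, ‖e i‖ = 1 := fun i => by simp [he]
  have hξ : ∀ i : Fin p, ∃ ξ : Eucl (p + q) → ℝ, CkBounded (m + 2) C₂ ξ (ball 0 (R / 4)) ∧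
      (∀ z ∈ ball (0 : Eucl (p + q)) (R / 4),
        ‖_root_.fderiv ℝ ξ z - innerSL ℝ (e i)‖ ≤ 30 * ε) ∧
      (∀ z ∈ ball (0 : Eucl (p + q)) (R / 4),
        f (g i z) - f (g (i + 1) z) = d (Fin.castAdd q i) / 2 * ξ z ^ 2) ∧ ξ 0 = 0 := by
    intro i
    have hi := hP i i.2.le
    refine helim hR (hRC.trans hCD) hσ (hσC.trans hCD) (hd i) hε0 (hε i.pos) (hen i)
      (fun x => headProj_succ (Fin.castAdd q i) x) ?_ (fun x => ?_) hi.symm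
      hi.norm_compl_le hi.idem hf (hG.mono le_rfl hCD) hG0 hDG (hg _ i.2).1 (hg _ i.2).2
      (hg _ i.2.le).1 (hg _ i.2.le).2
    · ext j
      simp only [headProj_apply, he, PiLp.single_apply, PiLp.zero_apply]
      split_ifs with h1 h2 <;> first | rfl | skip
      subst h2
      simp at h1
    · simp [he, EuclideanSpace.inner_single_left]
  choose ξ hξC hξD hξf hξ0 using hξ
  set P := headProj (p + q) p with hPdef
  have hPp := hP p le_rfl
  have hPsum : ∀ x, P x = ∑ i, inner ℝ (e i) x • e i := by
    intro x
    ext j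
    refine Fin.addCases (fun k => ?_) (fun k => ?_) j
    · rw [he, sum_smul_single_castAdd]
      simp [hPdef, headProj_apply, EuclideanSpace.inner_single_left]
    · rw [he, sum_smul_single_natAdd]
      simp [hPdef, headProj_apply]
  set Q : Eucl (p + q) →L[ℝ] Eucl (p + q) := ContinuousLinearMap.id ℝ _ - P with hQ
  have hQn : ∀ x, ‖Q x‖ ≤ ‖x‖ := fun x => by
    simpa using Q.le_of_opNorm_le hPp.norm_compl_le x
  -- The first `p` coordinates are replaced by the `ξ i` and the last `q` kept. Each replacement
  -- changes the derivative by at most `30 ε`, hence the hypothesis on `p * (30 * ε)`.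
  set Ψ : Eucl (p + q) → Eucl (p + q) := fun z => Q z + ∑ i, ξ i z • e i with hΨ
  have hR4 : 0 < R / 4 := by linarith
  have cΨ : CkBounded (m + 2) (max B C) Ψ (ball 0 (R / 4)) := by
    have h1 : CkBounded (m + 2) C (fun z => Q z) (ball 0 (R / 4)) :=
      of_clm isOpen_ball Q (hPp.norm_compl_le.trans hC) fun z hz =>
        (hQn z).trans ((mem_ball_zero_iff.1 hz).le.trans (by linarith))
    have h2 := CkBounded.sum (m := m + 2) (C := 1 * C₂) Finset.univ
      (f := fun i z => ξ i z • e i) (isOpen_ball (x := (0 : Eucl (p + q))) (ε := R / 4))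
      fun i _ => (hξC i).clm (ContinuousLinearMap.toSpanSingleton ℝ (e i)) (by simp [hen])
    rw [Finset.card_univ, Fintype.card_fin] at h2
    exact (h1.add h2).mono le_rfl ((le_max_right _ _).trans (le_max_left _ _))
  have hdΨ : ∀ z ∈ ball (0 : Eucl (p + q)) (R / 4),
      ‖_root_.fderiv ℝ Ψ z - ContinuousLinearMap.id ℝ _‖ ≤ 1 / 2 := by
    intro z hz
    have h1 : HasFDerivAt Ψ (Q + ∑ i, (_root_.fderiv ℝ (ξ i) z).smulRight (e i)) z :=
      Q.hasFDerivAt.add (HasFDerivAt.fun_sum fun i _ =>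
        ((hξC i).differentiableAt hz).hasFDerivAt.smul_const (e i))
    have h2 : Q + ∑ i, (_root_.fderiv ℝ (ξ i) z).smulRight (e i) - ContinuousLinearMap.id ℝ _ =
        ∑ i, (_root_.fderiv ℝ (ξ i) z - innerSL ℝ (e i)).smulRight (e i) := by
      ext1 v
      simp only [hQ, sub_apply, add_apply, ContinuousLinearMap.id_apply, hPsum,
        sum_apply, ContinuousLinearMap.smulRight_apply, sub_smul,
        Finset.sum_sub_distrib, innerSL_apply_apply]
      abel
    rw [h1.fderiv, h2]
    refine (norm_sum_le _ _).trans (le_trans ?_ hpε)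
    refine (Finset.sum_le_card_nsmul Finset.univ _ (30 * ε) fun i _ => ?_).trans (by simp)
    rw [ContinuousLinearMap.norm_smulRight_apply, hen, mul_one]
    exact hξD i z hz
  have hΨ0 : Ψ 0 = 0 := by simp [hΨ, hξ0]
  obtain ⟨Γ, hΓ1, hΓ2, hΓ3, -, hΓ5, hΓ6⟩ := exists_inverse_of_norm_fderiv_sub_id_le hR4
    (by norm_num) le_rfl hΨ0 (Nat.le_add_left 1 (m + 1)) cΨ.contDiffOn hdΨ
  rw [show (1 - 1 / 2 : ℝ) * (R / 4) = R / 8 by ring] at hΓ1 hΓ2 hΓ5 hΓ6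
  have hΓn := fun w hw => norm_le_two_of_mul_eq_one le_rfl (hdΨ _ (hΓ1 w hw)) (hΓ6 w hw).1
  have hΨi : ∀ z i, Ψ z (Fin.castAdd q i) = ξ i z := by
    intro z i
    simp only [hΨ, he, PiLp.add_apply, sum_smul_single_castAdd]
    simp [hQ, hPdef, headProj_apply]
  have hΨj : ∀ z, sndPart (Ψ z) = sndPart z := by
    intro z
    ext j
    simp only [hΨ, he, sndPart, PiLp.add_apply, sum_smul_single_natAdd]
    simp [hQ, hPdef, headProj_apply]
  obtain ⟨hν1, hν2, hν3, hν4⟩ := exists_critical_value (m := m + 1) hR hd0 hf hG.contDiffOn hG0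
    hDG0 hPp.symm (hg p le_rfl).1 (hg p le_rfl).2
  refine ⟨Γ, Ψ, fun y => f (g p (inrCLM p q y)), ?_, hΓ1, cΨ.contDiffOn, hΓ2, hΓ3, ?_,
    fun w hw => (hΓn w hw).1, fun w hw => ?_,
    hν1.mono (ball_subset_ball (by linarith)), hν2, hν3, hν4⟩
  · refine hinv cΨ isOpen_ball hΓ1 (fun w hw => ?_) (fun w hw => ?_) (fun w hw => ?_) hΓ6
    · exact (hΓ5.contDiffAt (isOpen_ball.mem_nhds hw)).differentiableAt
        (by exact_mod_cast Nat.succ_ne_zero (m + 1))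
    · exact (mem_ball_zero_iff.1 (hΓ1 w hw)).le.trans (le_max_of_le_right (by linarith))
    · exact (hΓn w hw).1.trans ((le_max_left _ _).trans (le_max_left _ _))
  · have := hΓ3 0 (mem_ball_self hR4)
    rwa [hΨ0] at this
  · set z := Γ w with hz
    have hzm : z ∈ ball (0 : Eucl (p + q)) (R / 4) := hΓ1 w hw
    have hzm' : z ∈ ball (0 : Eucl (p + q)) (3 / 4 * R) := ball_subset_ball (by linarith) hzm
    have hw' : w = Ψ z := (hΓ2 w hw).symm
    -- Telescoping over the eliminated variables; `g 0` is the identity since the projection is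
    -- zero, and `g p z` depends only on `sndPart z`.
    have htel : f (g 0 z) - f (g p z) =
        ∑ i : Fin p, d (Fin.castAdd q i) / 2 * w (Fin.castAdd q i) ^ 2 := by
      rw [← Finset.sum_range_sub' (fun i => f (g i z)) p,
        ← Fin.sum_univ_eq_sum_range (fun i => f (g i z) - f (g (i + 1) z))]
      refine Finset.sum_congr rfl fun i _ => ?_
      rw [hξf i z hzm, hw', hΨi]
    have hg0 : g 0 z = z := by
      refine (hg 0 (Nat.zero_le p)).2.unique z (ball_subset_ball (by linarith) hzm) ?_ z hzm' rfl
      exact headProj_zero _ _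
    have hgp : g p (inrCLM p q (sndPart w)) = g p z := by
      rw [hw', hΨj, ← sub_headProj_eq_inrCLM]
      refine (hg p le_rfl).2.unique _ ((hg p le_rfl).2.mapsTo z hzm')
        ((hg p le_rfl).2.crit z hzm') _ ?_ ?_
      · exact mem_ball_zero_iff.2 ((hQn z).trans_lt (mem_ball_zero_iff.1 hzm'))
      · rw [(hg p le_rfl).2.compl_eq z hzm', map_sub, hPp.idem, sub_self, sub_zero]
    simp only [hgp, ← htel, hg0]
    ring

end NormalForm

/-! ### Diagonalizing the Hessian; gradient and second derivative. -/

section Diagonalization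

/-- A symmetric operator of rank `p` is diagonal in an orthonormal basis whose first `p` vectors
have nonzero eigenvalues. -/
theorem exists_linearIsometryEquiv_diag {p q : ℕ} {L : Eucl (p + q) →ₗ[ℝ] Eucl (p + q)}
    (hL : L.IsSymmetric) (hrank : Module.finrank ℝ (LinearMap.range L) = p) :
    ∃ (Q : Eucl (p + q) ≃ₗᵢ[ℝ] Eucl (p + q)) (d : Fin (p + q) → ℝ),
      (∀ z, L (Q z) = Q (diagCLM d z)) ∧ (∀ i, singVal L p ≤ |d (Fin.castAdd q i)|) ∧
      ∀ j, d (Fin.natAdd p j) = 0 := by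
  classical
  have hn : Module.finrank ℝ (Eucl (p + q)) = p + q := by simp
  set ev := hL.eigenvalues hn with hev
  set b := hL.eigenvectorBasis hn with hb
  have hcard : Fintype.card {i // ev i ≠ 0} = p := by
    have h1 := hL.card_filter_eigenvalues_eq hn (0 : ℝ)
    rw [Module.End.eigenspace_zero] at h1
    have h2 := L.finrank_range_add_finrank_ker
    have h3 : Finset.card {i | ev i = 0} + Fintype.card {i // ev i ≠ 0} = p + q := by
      rw [Fintype.card_subtype, Finset.card_filter_add_card_filter_not, Finset.card_univ,
        Fintype.card_fin]
    have h4 : Finset.card {i | ev i = 0} = Module.finrank ℝ (LinearMap.ker L) := by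
      rw [← h1]
      rfl
    omega
  have hcard' : Fintype.card {i : Fin (p + q) // (i : ℕ) < p} = p := by
    have : Fintype.card (Fin p) = Fintype.card {i : Fin (p + q) // (i : ℕ) < p} :=
      Fintype.card_congr ⟨fun i => ⟨Fin.castAdd q i, by simp⟩, fun i => ⟨i.1, i.2⟩,
        fun i => rfl, fun i => rfl⟩
    rw [← this, Fintype.card_fin]
  -- Rank-nullity makes both sides have `p` elements; extending the bijection to a permutation
  -- brings the nonzero eigenvalues to the front.
  set e₀ : {i : Fin (p + q) // (i : ℕ) < p} ≃ {i // ev i ≠ 0} :=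
    Fintype.equivOfCardEq (hcard'.trans hcard.symm)
  set τ : Equiv.Perm (Fin (p + q)) := e₀.extendSubtype
  set b' := b.reindex τ.symm with hb'
  set d : Fin (p + q) → ℝ := fun i => ev (τ i) with hd
  have hLb : ∀ i, L (b' i) = d i • b' i := fun i => by
    rw [hb', OrthonormalBasis.reindex_apply, Equiv.symm_symm]
    exact hL.apply_eigenvectorBasis hn (τ i)
  refine ⟨b'.repr.symm, d, fun z => ?_, fun i => ?_, fun j => ?_⟩
  · rw [← b'.sum_repr_symm, ← b'.sum_repr_symm, map_sum]
    refine Finset.sum_congr rfl fun i _ => ?_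
    rw [map_smul, hLb, diagCLM_apply, smul_smul, mul_comm]
  · have hp : p ≠ 0 := i.pos.ne'
    have hdi : d (Fin.castAdd q i) ≠ 0 := e₀.extendSubtype_mem _ (by simp)
    set μ := d (Fin.castAdd q i)
    -- Thus `|μ|` is a singular value. Being positive it has zero-based index `j < p`, so it is at
    -- least the one of index `p - 1`, which is `singVal L p`.
    have hsv : Module.End.HasEigenvalue (LinearMap.adjoint L ∘ₗ L) (μ ^ 2) := by
      refine Module.End.hasEigenvalue_of_hasEigenvector (x := b' (Fin.castAdd q i))
        ⟨Module.End.mem_eigenspace_iff.2 ?_, b'.orthonormal.ne_zero _⟩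
      have hadj : LinearMap.adjoint L = L := by
        refine ((LinearMap.eq_adjoint_iff L L).2 fun x y => hL x y).symm
      rw [hadj, LinearMap.comp_apply, hLb, map_smul, hLb, smul_smul, pow_two]
    obtain ⟨j, hj⟩ := L.isSymmetric_adjoint_comp_self.exists_eigenvalues_eq hn hsv
    have hj' : L.singularValues j ^ 2 = μ ^ 2 := by
      rw [L.sq_singularValues_fin hn]
      simpa using hj
    have hj2 : L.singularValues j = |μ| := by
      rw [← abs_of_nonneg (L.singularValues_nonneg j)]
      exact (sq_eq_sq_iff_abs_eq_abs _ _).1 hj'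
    have hjp : (j : ℕ) < p :=
      (L.singularValues_pos_iff_lt_finrank_range.1 (hj2 ▸ abs_pos.2 hdi)).trans_eq hrank
    rw [singVal, if_neg hp, ← hj2]
    exact L.singularValues_antitone (by omega)
  · by_contra h
    exact e₀.extendSubtype_not_mem (Fin.natAdd p j) (by simp) h

theorem singVal_pos {n p : ℕ} {L : Eucl n →ₗ[ℝ] Eucl n}
    (hrank : Module.finrank ℝ (LinearMap.range L) = p) : 0 < singVal L p := by
  rw [singVal]
  split_ifs with hp
  · exact one_pos
  · rw [L.singularValues_pos_iff_lt_finrank_range]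
    omega

/-- The Riesz isomorphism from the dual space, over the reals. -/
noncomputable def dualIso (n : ℕ) : (Eucl n →L[ℝ] ℝ) ≃ₗᵢ[ℝ] Eucl n :=
  (InnerProductSpace.toDual ℝ (Eucl n)).symm

theorem inner_dualIso {n : ℕ} (ℓ : Eucl n →L[ℝ] ℝ) (w : Eucl n) :
    inner ℝ (dualIso n ℓ) w = ℓ w :=
  InnerProductSpace.toDual_symm_apply

theorem gradient_eq_dualIso {n : ℕ} (f : Eucl n → ℝ) :
    gradient f = fun x => dualIso n (fderiv ℝ f x) := rfl

theorem hasFDerivAt_gradient {n : ℕ} {f : Eucl n → ℝ} {x : Eucl n}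
    (hf : DifferentiableAt ℝ (fderiv ℝ f) x) :
    HasFDerivAt (gradient f) (((dualIso n).toContinuousLinearEquiv :
      (Eucl n →L[ℝ] ℝ) →L[ℝ] Eucl n).comp (fderiv ℝ (fderiv ℝ f) x)) x :=
  (dualIso n).toContinuousLinearEquiv.hasFDerivAt.comp x hf.hasFDerivAt

theorem inner_fderiv_gradient {n : ℕ} {f : Eucl n → ℝ} {x : Eucl n}
    (hf : DifferentiableAt ℝ (fderiv ℝ f) x) (v w : Eucl n) :
    inner ℝ (fderiv ℝ (gradient f) x v) w = fderiv ℝ (fderiv ℝ f) x v w := by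
  rw [(hasFDerivAt_gradient hf).fderiv]
  exact inner_dualIso _ w

theorem isSymmetric_hessMap {n : ℕ} {f : Eucl n → ℝ} {x : Eucl n} (hf : ContDiffAt ℝ 2 f x) :
    (hessMap f x).IsSymmetric := by
  have hd : DifferentiableAt ℝ (fderiv ℝ f) x :=
    (hf.fderiv_right (m := 1) (by norm_num)).differentiableAt one_ne_zero
  intro v w
  rw [real_inner_comm]
  simp only [hessMap, ContinuousLinearMap.coe_coe]
  rw [real_inner_comm, inner_fderiv_gradient hd, real_inner_comm, inner_fderiv_gradient hd]
  exact (hf.isSymmSndFDerivAt (by simp)) v w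

end Diagonalization

/-! ### Arithmetic of the radius. -/

section Radius

theorem splitRadius_pos {K σ : ℝ} (p : ℕ) (hK : 0 ≤ K) (hσ : 0 < σ) : 0 < splitRadius K σ p := by
  unfold splitRadius
  have : 0 < K + 1 := by linarith
  positivity

/-- The left side is the working radius `R`: `√(2 / σ)` bounds the final rescaling, and the normal
form on radius `R` lives on `R / 8`. Only the last entry of the minimum in `splitRadius` is needed.
-/
theorem sqrt_mul_splitRadius_le {K σ : ℝ} (p : ℕ) (hK : 0 ≤ K) (hσ : 0 < σ) (hσK : σ ≤ K + 1) :
    8 * (√(2 / σ) * splitRadius K σ p) ≤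
      √2 * σ ^ 3 / (8 * (K + 1) ^ 4 * ((p : ℝ) ^ 2 + p + 1)) := by
  set N : ℝ := (p : ℝ) ^ 2 + p + 1 with hN
  have hNpos : 0 < N := by positivity
  have hL : 0 < K + 1 := by linarith
  set s := √σ with hs
  set l := √(K + 1) with hl
  have hspos : 0 < s := Real.sqrt_pos.2 hσ
  have hlpos : 0 < l := Real.sqrt_pos.2 hL
  have hsl : s ≤ l := Real.sqrt_le_sqrt hσK
  have hs2 : σ = s ^ 2 := (Real.sq_sqrt hσ.le).symm
  have hl2 : K + 1 = l ^ 2 := (Real.sq_sqrt hL.le).symm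
  have e1 : σ ^ (5 / 2 : ℝ) = s ^ 5 := by
    rw [hs, Real.sqrt_eq_rpow, ← Real.rpow_natCast, ← Real.rpow_mul hσ.le]; norm_num
  have e2 : σ ^ (3 / 2 : ℝ) = s ^ 3 := by
    rw [hs, Real.sqrt_eq_rpow, ← Real.rpow_natCast, ← Real.rpow_mul hσ.le]; norm_num
  have e3 : (K + 1) ^ (9 / 2 : ℝ) = l ^ 9 := by
    rw [hl, Real.sqrt_eq_rpow, ← Real.rpow_natCast, ← Real.rpow_mul hL.le]; norm_num
  have h1 : splitRadius K σ p ≤ s ^ 5 / (32 * l ^ 9) * (s ^ 3 / (2 * N)) := by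
    rw [splitRadius, e1, e2, e3]
    gcongr
    exact (min_le_right _ _).trans (min_le_right _ _)
  have h2 : √(2 / σ) = √2 / s := Real.sqrt_div zero_le_two σ
  calc 8 * (√(2 / σ) * splitRadius K σ p)
      ≤ 8 * (√2 / s * (s ^ 5 / (32 * l ^ 9) * (s ^ 3 / (2 * N)))) := by rw [h2]; gcongr
    _ = √2 * s ^ 6 / (8 * l ^ 8 * N) * (s / l) := by field_simp; norm_num
    _ ≤ √2 * s ^ 6 / (8 * l ^ 8 * N) * 1 := by
        gcongr
        exact (div_le_one hlpos).2 hsl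
    _ = √2 * σ ^ 3 / (8 * (K + 1) ^ 4 * N) := by rw [hs2, hl2, mul_one]; ring

/-- This bounds `ε = K R / σ`. It uses `K / (K + 1) ^ 2 ≤ 1 / 4` and `√2 ≤ 16 / 11`, and `(16 / 11)
(1 / 4) (1 / 8) = 1 / 22`. -/
theorem mul_div_le_of_splitRadius {K σ : ℝ} (p : ℕ) (hK : 0 ≤ K) (hσ : 0 < σ)
    (hσK : σ ≤ K + 1) :
    K * (8 * (√(2 / σ) * splitRadius K σ p)) / σ ≤ 1 / (22 * ((p : ℝ) ^ 2 + p + 1)) := by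
  have h := sqrt_mul_splitRadius_le p hK hσ hσK
  set N : ℝ := (p : ℝ) ^ 2 + p + 1 with hN
  have hNpos : 0 < N := by positivity
  have hL : 0 < K + 1 := by linarith
  have h2 : √2 ≤ 16 / 11 := by
    rw [Real.sqrt_le_left (by norm_num)]; norm_num
  have h3 : K / (K + 1) ^ 2 ≤ 1 / 4 := by
    rw [div_le_div_iff₀ (by positivity) (by norm_num)]
    nlinarith [sq_nonneg (K - 1)]
  have h4 : σ ^ 2 / (K + 1) ^ 2 ≤ 1 := by
    rw [div_le_one (by positivity)]
    gcongr
  calc K * (8 * (√(2 / σ) * splitRadius K σ p)) / σ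
      ≤ K * (√2 * σ ^ 3 / (8 * (K + 1) ^ 4 * N)) / σ := by gcongr
    _ = √2 * (K / (K + 1) ^ 2) * (σ ^ 2 / (K + 1) ^ 2) * (1 / (8 * N)) := by field_simp
    _ ≤ 16 / 11 * (1 / 4) * 1 * (1 / (8 * N)) := by gcongr
    _ = 1 / (22 * N) := by field_simp; norm_num

/-- It places the ball of radius `R` about `x₀` inside `U`. The product form, without division by
`K`, covers `K = 0`. -/
theorem two_mul_sqrt_mul_splitRadius_lt_one {K σ : ℝ} (p : ℕ) (hK : 0 ≤ K) (hσ : 0 < σ)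
    (hσK : σ ≤ K + 1) :
    2 * K * √(1 + (K + 1) ^ 2 / σ ^ 2) * (8 * (√(2 / σ) * splitRadius K σ p)) < 1 := by
  have h := sqrt_mul_splitRadius_le p hK hσ hσK
  set N : ℝ := (p : ℝ) ^ 2 + p + 1 with hN
  have hNpos : 1 ≤ N := by rw [hN]; nlinarith [sq_nonneg (p : ℝ), Nat.cast_nonneg (α := ℝ) p]
  have hL : 0 < K + 1 := by linarith
  have h1 : √(1 + (K + 1) ^ 2 / σ ^ 2) ≤ √2 * ((K + 1) / σ) := by
    have : √2 * ((K + 1) / σ) = √(2 * ((K + 1) / σ) ^ 2) := by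
      rw [Real.sqrt_mul zero_le_two, Real.sqrt_sq (by positivity)]
    rw [this]
    apply Real.sqrt_le_sqrt
    have h3 : 1 ≤ (K + 1) / σ := (one_le_div hσ).2 hσK
    rw [div_pow]
    have : 1 ≤ (K + 1) ^ 2 / σ ^ 2 := by rw [← div_pow]; exact one_le_pow₀ h3
    linarith
  have h4 : σ ^ 2 / (K + 1) ^ 2 ≤ 1 := by
    rw [div_le_one (by positivity)]
    gcongr
  have h5 : K / (K + 1) ≤ 1 := (div_le_one hL).2 (by linarith)
  have h6 : √2 * √2 = 2 := Real.mul_self_sqrt zero_le_two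
  calc 2 * K * √(1 + (K + 1) ^ 2 / σ ^ 2) * (8 * (√(2 / σ) * splitRadius K σ p))
      ≤ 2 * K * (√2 * ((K + 1) / σ)) * (√2 * σ ^ 3 / (8 * (K + 1) ^ 4 * N)) := by
        have := (splitRadius_pos p hK hσ).le
        gcongr
    _ = (√2 * √2) / 4 * (K / (K + 1)) * (σ ^ 2 / (K + 1) ^ 2) * (1 / N) := by
        field_simp
        ring
    _ ≤ 2 / 4 * 1 * 1 * (1 / 1) := by rw [h6]; gcongr
    _ < 1 := by norm_num

/-- The factor `2` bounds the derivative of the local inverse, and `√(2 / σ)` bounds the rescaling.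
-/
theorem two_mul_sqrt_le {K σ : ℝ} (hK : 0 ≤ K) (hσ : 0 < σ) (hσK : σ ≤ K + 1) :
    2 * √(2 / σ) ≤ 32 * (K + 1) ^ 5 / σ ^ (5 / 2 : ℝ) := by
  set s := √σ with hs
  have hspos : 0 < s := Real.sqrt_pos.2 hσ
  have hs2 : σ = s ^ 2 := (Real.sq_sqrt hσ.le).symm
  have e1 : σ ^ (5 / 2 : ℝ) = s ^ 5 := by
    rw [hs, Real.sqrt_eq_rpow, ← Real.rpow_natCast, ← Real.rpow_mul hσ.le]; norm_num
  have h2 : √2 ≤ 2 := by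
    rw [Real.sqrt_le_left (by norm_num)]; norm_num
  rw [e1, Real.sqrt_div zero_le_two, ← hs, le_div_iff₀ (by positivity)]
  calc 2 * (√2 / s) * s ^ 5 = 2 * √2 * σ ^ 2 := by rw [hs2]; field_simp
    _ ≤ 2 * 2 * (K + 1) ^ 2 := by gcongr
    _ ≤ 32 * (K + 1) ^ 5 := by
        have h3 : (K + 1) ^ 2 ≤ (K + 1) ^ 5 :=
          pow_le_pow_right₀ (by linarith) (by norm_num)
        nlinarith [sq_nonneg (K + 1)]

end Radius

/-! ### Assembling the diffeomorphism. -/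

section Splitting

/-- The gradient field of `f`, pulled back along the rigid motion `z ↦ x₀ + Q z`. -/
theorem CkBounded.pullback_gradient {n m : ℕ} {f : Eucl n → ℝ} {U : Set (Eucl n)} {K R : ℝ}
    (hU : IsOpen U) (hf : ContDiffOn ℝ (m + 3 : ℕ) f U) (hK : CkNormLE (m + 3) f U K)
    {x₀ : Eucl n} (Q : Eucl n ≃ₗᵢ[ℝ] Eucl n)
    (hR : ∀ z ∈ ball (0 : Eucl n) R, x₀ + Q z ∈ U) :
    (∀ z ∈ ball (0 : Eucl n) R, HasFDerivAt (fun z => f (x₀ + Q z))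
      (innerSL ℝ (Q.symm (gradient f (x₀ + Q z)))) z) ∧
    CkBounded (m + 2) K (fun z => Q.symm (gradient f (x₀ + Q z))) (ball 0 R) := by
  have hcf : ContDiffOn ℝ (m + 2 : ℕ) (_root_.fderiv ℝ f) U :=
    hf.fderiv_of_isOpen hU (by norm_cast)
  refine ⟨fun z hz => ?_, isOpen_ball, ?_, fun j hj z hz => ?_⟩
  · have h1 : HasFDerivAt f (_root_.fderiv ℝ f (x₀ + Q z)) (x₀ + Q z) :=
      ((hf.contDiffAt (hU.mem_nhds (hR z hz))).differentiableAt
        (by exact_mod_cast Nat.succ_ne_zero (m + 2))).hasFDerivAt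
    have h2 : HasFDerivAt (fun z => x₀ + Q z) (Q.toContinuousLinearEquiv : Eucl n →L[ℝ] Eucl n) z :=
      Q.toContinuousLinearEquiv.hasFDerivAt.const_add x₀
    refine (h1.comp z h2).congr_fderiv ?_
    ext v
    rw [innerSL_apply_apply, Q.symm.inner_map_eq_flip, Q.symm_symm, gradient_eq_dualIso,
      inner_dualIso]
    rfl
  · refine Q.symm.contDiff.comp_contDiffOn ((dualIso n).contDiff.comp_contDiffOn
      (hcf.comp (contDiff_const.add Q.contDiff).contDiffOn hR))
  · have h1 : (fun z => Q.symm (gradient f (x₀ + Q z))) =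
        Q.symm ∘ (dualIso n ∘ ((fun y => _root_.fderiv ℝ f (x₀ + y)) ∘ Q)) := rfl
    rw [h1, Q.symm.norm_iteratedFDeriv_comp_left, (dualIso n).norm_iteratedFDeriv_comp_left,
      Q.norm_iteratedFDeriv_comp_right, iteratedFDeriv_comp_add_left, norm_iteratedFDeriv_fderiv]
    exact hK (j + 1) (by omega) (by omega) _ (hR z hz)

/-- Mean value inequality for `DG`. With `G` the gradient, this uses the bound on third derivatives
of `f`, hence `k ≥ 3`. -/
theorem norm_fderiv_sub_le_of_ckBounded {E F : Type*} [NormedAddCommGroup E] [NormedSpace ℝ E]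
    [NormedAddCommGroup F] [NormedSpace ℝ F] {m : ℕ} {K R : ℝ} {G : E → F}
    (hG : CkBounded (m + 2) K G (ball 0 R)) (hR : 0 < R) (hK : 0 ≤ K) {z : E}
    (hz : z ∈ ball (0 : E) R) : ‖fderiv ℝ G z - fderiv ℝ G 0‖ ≤ K * R := by
  have h := (convex_ball (0 : E) R).norm_image_sub_le_of_norm_fderiv_le (𝕜 := ℝ)
    (f := fderiv ℝ G) (C := K) (fun x hx => hG.fderiv.differentiableAt hx)
    (fun x hx => hG.fderiv.norm_fderiv_le hx) (mem_ball_self hR) hz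
  refine h.trans ?_
  rw [sub_zero]
  gcongr
  exact (mem_ball_zero_iff.1 hz).le

/-- Rescaling the variable and subtracting a constant preserves vanishing of the first two
derivatives at the origin. -/
theorem fderiv_comp_smul_sub_const {q : ℕ} {ν : Eucl q → ℝ} (c b : ℝ) (h1 : fderiv ℝ ν 0 = 0)
    (h2 : iteratedFDeriv ℝ 2 ν 0 = 0) :
    fderiv ℝ (fun y => ν (c • y) - b) 0 = 0 ∧
      iteratedFDeriv ℝ 2 (fun y => ν (c • y) - b) 0 = 0 := by
  have e1 : fderiv ℝ (fun y => ν (c • y) - b) = fun y => c • fderiv ℝ ν (c • y) := by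
    ext1 y
    rw [fderiv_sub_const, fderiv_comp_smul]
  have e2 : ‖fderiv ℝ (fderiv ℝ ν) 0‖ = 0 := by
    rw [← norm_iteratedFDeriv_one, norm_iteratedFDeriv_fderiv, h2, norm_zero]
  refine ⟨by rw [e1]; simp [h1], ?_⟩
  rw [← norm_eq_zero, ← norm_iteratedFDeriv_fderiv, norm_iteratedFDeriv_one, e1, norm_eq_zero]
  have e3 : fderiv ℝ (fun y => c • fderiv ℝ ν (c • y)) 0 =
      c • fderiv ℝ (fun y => fderiv ℝ ν (c • y)) 0 :=
    congrFun (fderiv_const_smul_field (𝕜 := ℝ) (f := fun y => fderiv ℝ ν (c • y)) c) 0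
  have e4 : fderiv ℝ (fderiv ℝ ν) 0 = 0 := by
    rw [← norm_iteratedFDeriv_one, norm_eq_zero] at e2
    ext v w
    have := congrArg (fun L => L (fun _ => v) w) e2
    simpa using this
  rw [e3, fderiv_comp_smul, smul_zero, e4]
  simp

/-- The map `z ↦ x₀ + Q (Γ (D z))`, for `Γ` a diffeomorphism with inverse `Ψ`, `Q` an isometry and
`D` an invertible operator. -/
theorem isCkDiffeoOn_comp {n m : ℕ} {Γ Ψ : Eucl n → Eucl n} {S T : Set (Eucl n)} {r : ℝ}
    (x₀ : Eucl n) (Q : Eucl n ≃ₗᵢ[ℝ] Eucl n) {D D' : Eucl n →L[ℝ] Eucl n}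
    (hDD' : ∀ z, D (D' z) = z) (hD'D : ∀ z, D' (D z) = z) (hD : MapsTo D (ball 0 r) S)
    (hΓ : ContDiffOn ℝ m Γ S) (hΓT : MapsTo Γ S T) (hT : IsOpen T) (hΨ : ContDiffOn ℝ m Ψ T)
    (hΨΓ : ∀ w ∈ S, Ψ (Γ w) = w) (hΓΨ : ∀ z ∈ T, Γ (Ψ z) = z) :
    IsCkDiffeoOn m (fun z => x₀ + Q (Γ (D z))) (ball 0 r) := by
  -- The image of the ball is a rigid motion of `V`, so its openness follows from continuity of the
  -- explicit inverse.
  set V : Set (Eucl n) := T ∩ (fun y => D' (Ψ y)) ⁻¹' ball 0 r with hV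
  have hVopen : IsOpen V :=
    (D'.continuous.comp_continuousOn hΨ.continuousOn).isOpen_inter_preimage hT isOpen_ball
  have himage : (fun z => x₀ + Q (Γ (D z))) '' ball 0 r = (fun x => Q.symm (x - x₀)) ⁻¹' V := by
    ext x
    constructor
    · rintro ⟨z, hz, rfl⟩
      have h1 : Γ (D z) ∈ T := hΓT (hD hz)
      simpa [hV, hΨΓ _ (hD hz), hD'D, h1] using hz
    · rintro ⟨h1, h2⟩
      refine ⟨_, h2, ?_⟩
      simp only [hDD']
      rw [hΓΨ _ h1]
      simp
  refine ⟨contDiffOn_const.add (Q.contDiff.comp_contDiffOn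
    (hΓ.comp D.contDiff.contDiffOn hD)), ?_, fun x => D' (Ψ (Q.symm (x - x₀))), ?_, ?_⟩
  · rw [himage]
    exact hVopen.preimage (Q.symm.continuous.comp (continuous_id.sub continuous_const))
  · rw [himage]
    exact D'.contDiff.comp_contDiffOn (hΨ.comp
      (Q.symm.contDiff.comp (contDiff_id.sub contDiff_const)).contDiffOn fun x hx => hx.1)
  · intro z hz
    simp [hΨΓ _ (hD hz), hD'D]

/-- Normalizing the coefficients of a diagonal quadratic form to `±1`. -/
theorem half_mul_sqrt_mul_sq {d : ℝ} (hd : d ≠ 0) (x : ℝ) :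
    d / 2 * (√(2 / |d|) * x) ^ 2 = SignType.sign d * x ^ 2 := by
  have h : 0 < |d| := abs_pos.2 hd
  rw [mul_pow, Real.sq_sqrt (by positivity)]
  have : (SignType.sign d : ℝ) * |d| = d := sign_mul_abs d
  rw [eq_div_of_mul_eq h.ne' this]
  field_simp

theorem norm_fderiv_isometry_comp_le {n : ℕ} {Γ : Eucl n → Eucl n} (x₀ : Eucl n)
    (Q : Eucl n ≃ₗᵢ[ℝ] Eucl n) {D : Eucl n →L[ℝ] Eucl n} {c : ℝ} (hD : ‖D‖ ≤ c) {z : Eucl n}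
    (hΓ : DifferentiableAt ℝ Γ (D z)) (hΓ2 : ‖fderiv ℝ Γ (D z)‖ ≤ 2) :
    ‖fderiv ℝ (fun z => x₀ + Q (Γ (D z))) z‖ ≤ 2 * c := by
  have h1 : HasFDerivAt (fun z => x₀ + Q (Γ (D z)))
      ((Q.toContinuousLinearEquiv : Eucl n →L[ℝ] Eucl n).comp ((fderiv ℝ Γ (D z)).comp D)) z :=
    (Q.toContinuousLinearEquiv.hasFDerivAt.comp z
      (hΓ.hasFDerivAt.comp z D.hasFDerivAt)).const_add x₀
  rw [h1.fderiv]
  have hc : 0 ≤ c := (norm_nonneg _).trans hD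
  refine ContinuousLinearMap.opNorm_le_bound _ (by positivity) fun v => ?_
  have h2 : ‖Q (fderiv ℝ Γ (D z) (D v))‖ ≤ 2 * c * ‖v‖ := by
    rw [Q.norm_map, mul_assoc]
    refine (ContinuousLinearMap.le_of_opNorm_le _ hΓ2 _).trans ?_
    gcongr
    exact D.le_of_opNorm_le hD v
  exact h2

/-- The eigenvalues of the Hessian are bounded by the second derivative. -/
theorem abs_le_of_hessMap_diag {n : ℕ} {f : Eucl n → ℝ} {x₀ : Eucl n} {K : ℝ}
    (hf : DifferentiableAt ℝ (fderiv ℝ f) x₀) (hK : ‖iteratedFDeriv ℝ 2 f x₀‖ ≤ K)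
    {Q : Eucl n ≃ₗᵢ[ℝ] Eucl n} {d : Fin n → ℝ}
    (hQ : ∀ z, hessMap f x₀ (Q z) = Q (diagCLM d z)) (j : Fin n) : |d j| ≤ K := by
  have hK0 : 0 ≤ K := (norm_nonneg _).trans hK
  rw [← norm_iteratedFDeriv_fderiv, norm_iteratedFDeriv_one] at hK
  set v : Eucl n := EuclideanSpace.single j 1 with hv
  have h1 : ‖fderiv ℝ (gradient f) x₀ (Q v)‖ ≤ K * ‖Q v‖ := by
    rw [(hasFDerivAt_gradient hf).fderiv]
    change ‖dualIso n (fderiv ℝ (fderiv ℝ f) x₀ (Q v))‖ ≤ _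
    rw [LinearIsometryEquiv.norm_map]
    exact ContinuousLinearMap.le_of_opNorm_le _ hK _
  have h3 : fderiv ℝ (gradient f) x₀ (Q v) = Q (diagCLM d v) := hQ v
  have h4 : ‖v‖ = 1 := by simp [hv]
  have h6 : v j = 1 := by simp [hv]
  have h5 := PiLp.norm_apply_le (diagCLM d v) j
  rw [diagCLM_apply, h6, mul_one, Real.norm_eq_abs] at h5
  rw [h3, Q.norm_map, Q.norm_map, h4, mul_one] at h1
  exact h5.trans h1

set_option maxHeartbeats 1000000 in
theorem exists_splitting (K σ : ℝ) (p m : ℕ) : ∃ M : ℝ, 0 < M ∧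
    ∀ (q : ℕ) (U : Set (Eucl (p + q))) (_ : IsOpen U)
      (x₀ : Eucl (p + q)) (_ : x₀ ∈ U) (f : Eucl (p + q) → ℝ)
      (_ : ContDiffOn ℝ (m + 3 : ℕ) f U) (_ : CkNormLE (m + 3) f U K) (_ : fderiv ℝ f x₀ = 0)
      (_ : Module.finrank ℝ (LinearMap.range (hessMap f x₀)) = p)
      (_ : σ = singVal (hessMap f x₀) p)
      (_ : ∀ z : Eucl (p + q),
        2 * K * Real.sqrt (1 + (K + 1) ^ 2 / σ ^ 2) * ‖z - x₀‖ < 1 → z ∈ U),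
      ∃ (φ : Eucl (p + q) → Eucl (p + q)) (ε : Fin p → ℝ) (α : Eucl q → ℝ),
        IsCkDiffeoOn (m + 2) φ (ball 0 (splitRadius K σ p)) ∧
        MapsTo φ (ball 0 (splitRadius K σ p)) U ∧
        φ 0 = x₀ ∧
        (∀ z ∈ ball (0 : Eucl (p + q)) (splitRadius K σ p),
          ‖fderiv ℝ φ z‖ ≤ 32 * (K + 1) ^ 5 / σ ^ (5 / 2 : ℝ)) ∧
        (∀ i, ε i = 1 ∨ ε i = -1) ∧
        (∀ z ∈ ball (0 : Eucl (p + q)) (splitRadius K σ p),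
          f (φ z) = f x₀ + ∑ i, ε i * fstPart z i ^ 2 + α (sndPart z)) ∧
        ContDiffOn ℝ (m + 3 : ℕ) α (ball 0 (splitRadius K σ p)) ∧
        α 0 = 0 ∧ fderiv ℝ α 0 = 0 ∧ iteratedFDeriv ℝ 2 α 0 = 0 ∧
        CkNormLE (m + 2) φ (ball 0 (splitRadius K σ p)) M := by
  set δ := splitRadius K σ p with hδ
  set c : ℝ := √(2 / σ) with hc
  have hc0 : 0 ≤ c := Real.sqrt_nonneg _
  set R : ℝ := 8 * (c * δ) with hRdef
  -- The constant is fixed before any hypothesis on `K` and `σ` is at hand, hence the absolute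
  -- values.
  set C : ℝ := 1 + |K| + |σ⁻¹| + |R| with hCdef
  have hC : 1 ≤ C := by
    have := abs_nonneg K; have := abs_nonneg σ⁻¹; have := abs_nonneg R; linarith
  have hC0 : 0 ≤ C := zero_le_one.trans hC
  obtain ⟨C₁, hC₁, hnf⟩ := CkBounded.exists_normal_form m p C hC
  refine ⟨1 * ((m + 2).factorial * C₁ * max 1 (c + C) ^ (m + 2)) + 1, by positivity, ?_⟩
  intro q U hU x₀ hx₀ f hf hK hcrit hrank hσ hball
  have hσpos : 0 < σ := hσ ▸ singVal_pos hrank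
  have hK0 : 0 ≤ K := (norm_nonneg _).trans (hK 1 le_rfl (by omega) x₀ hx₀)
  have hf2 : ContDiffAt ℝ 2 f x₀ :=
    (hf.contDiffAt (hU.mem_nhds hx₀)).of_le (by norm_cast; omega)
  have hddf : DifferentiableAt ℝ (fderiv ℝ f) x₀ :=
    (hf2.fderiv_right (m := 1) (by norm_num)).differentiableAt one_ne_zero
  obtain ⟨Q, d, hQ, hd, hd0⟩ := exists_linearIsometryEquiv_diag (isSymmetric_hessMap hf2) hrank
  rw [← hσ] at hd
  have hδpos : 0 < δ := splitRadius_pos p hK0 hσpos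
  have hcpos : 0 < c := Real.sqrt_pos.2 (by positivity)
  have hRpos : 0 < R := by positivity
  have hd_ne : ∀ i, d (Fin.castAdd q i) ≠ 0 := fun i => abs_pos.1 (hσpos.trans_le (hd i))
  set G : Eucl (p + q) → Eucl (p + q) := fun z => Q.symm (gradient f (x₀ + Q z)) with hG
  have hDG0 : fderiv ℝ G 0 = diagCLM d := by
    have h1 : HasFDerivAt (gradient f) (fderiv ℝ (gradient f) x₀) (x₀ + Q 0) := by
      rw [map_zero, add_zero]
      exact (hasFDerivAt_gradient hddf).differentiableAt.hasFDerivAt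
    have h2 : HasFDerivAt (fun z => x₀ + Q z)
        (Q.toContinuousLinearEquiv : Eucl (p + q) →L[ℝ] Eucl (p + q)) 0 :=
      Q.toContinuousLinearEquiv.hasFDerivAt.const_add x₀
    have h3 := Q.symm.toContinuousLinearEquiv.hasFDerivAt.comp (0 : Eucl (p + q))
      (HasFDerivAt.comp (0 : Eucl (p + q)) h1 h2)
    refine h3.fderiv.trans ?_
    ext1 v
    change Q.symm (hessMap f x₀ (Q v)) = _
    rw [hQ, Q.symm_apply_apply]
  have hsmall : ∀ r ≤ R, ∀ z ∈ ball (0 : Eucl (p + q)) r, σ ≤ K + 1 → x₀ + Q z ∈ U := by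
    intro r hr z hz hσK
    refine hball _ (lt_of_le_of_lt ?_ (two_mul_sqrt_mul_splitRadius_lt_one p hK0 hσpos hσK))
    rw [add_sub_cancel_left, Q.norm_map]
    gcongr
    exact (mem_ball_zero_iff.1 hz).le.trans hr
  -- For `p = 0` the convention `σ = 1` enters; otherwise `σ` is at most an eigenvalue modulus,
  -- which is at most `K`.
  have hσK : σ ≤ K + 1 := by
    rcases Nat.eq_zero_or_pos p with hp | hp
    · rw [hσ, singVal, if_pos hp]
      linarith
    · linarith [hd ⟨0, hp⟩, abs_le_of_hessMap_diag hddf (hK 2 (by omega) (by omega) x₀ hx₀) hQ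
        (Fin.castAdd q ⟨0, hp⟩)]
  obtain ⟨hF, hGC⟩ := CkBounded.pullback_gradient hU hf hK Q (R := R) (x₀ := x₀)
    fun z hz => hsmall R le_rfl z hz hσK
  have hG0 : G 0 = 0 := by
    simp [hG, gradient_eq_dualIso, hcrit]
  set ε : ℝ := K * R / σ with hε
  set N : ℝ := (p : ℝ) ^ 2 + p + 1 with hN
  have hN1 : 1 ≤ N := by rw [hN]; nlinarith [sq_nonneg (p : ℝ), Nat.cast_nonneg (α := ℝ) p]
  -- `N - 3 p = (p - 1) ^ 2`. Hence `30 p ε ≤ 30 / 66`, and `ε ≤ 1 / 66` as soon as `p ≥ 1`; for `p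
  -- = 0` only `ε ≤ 1 / 22` holds, which suffices because nothing is eliminated.
  have hN3 : 3 * (p : ℝ) ≤ N := by rw [hN]; nlinarith [sq_nonneg ((p : ℝ) - 1)]
  have hε0 : 0 ≤ ε := by positivity
  have hεN : ε ≤ 1 / (22 * N) := mul_div_le_of_splitRadius p hK0 hσpos hσK
  have hεN' : ε * (22 * N) ≤ 1 := by
    rwa [le_div_iff₀ (by positivity)] at hεN
  have hKC : K ≤ C := by
    have := le_abs_self K; have := abs_nonneg σ⁻¹; have := abs_nonneg R; linarith
  have hRC : R ≤ C := by
    have := le_abs_self R; have := abs_nonneg σ⁻¹; have := abs_nonneg K; linarith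
  have hσC : σ⁻¹ ≤ C := by
    have := le_abs_self σ⁻¹; have := abs_nonneg R; have := abs_nonneg K; linarith
  obtain ⟨Γ, Ψ, ν, hΓC, hΓm, hΨ, hΨΓ, hΓΨ, hΓ0, hΓn, hnormal, hν, hν0, hν1, hν2⟩ :=
    hnf (f := fun z => f (x₀ + Q z)) hRpos hRC hσpos hσC hε0 (by nlinarith)
      (fun hp => by
        have : (1 : ℝ) ≤ p := by exact_mod_cast hp
        nlinarith) (by nlinarith) hd hd0 hF (hGC.mono le_rfl hKC) hG0 hDG0
      (fun z hz => by
        rw [← hDG0, hε, mul_div_cancel₀ _ hσpos.ne']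
        exact norm_fderiv_sub_le_of_ckBounded hGC hRpos hK0 hz)
  -- The first factors normalize the coefficients to `±1`. They are at most `c`, which is used on
  -- the remaining axes.
  set t : Fin (p + q) → ℝ := Fin.append (fun i => √(2 / |d (Fin.castAdd q i)|)) (fun _ => c)
    with ht
  have htpos : ∀ j, 0 < t j := fun j => by
    refine Fin.addCases (fun i => ?_) (fun i => ?_) j
    · rw [ht, Fin.append_left]
      have := abs_pos.2 (hd_ne i)
      exact Real.sqrt_pos.2 (by positivity)
    · rw [ht, Fin.append_right]
      exact hcpos
  have htc : ∀ j, |t j| ≤ c := fun j => by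
    rw [abs_of_pos (htpos j)]
    refine Fin.addCases (fun i => ?_) (fun i => ?_) j
    · rw [ht, Fin.append_left]
      apply Real.sqrt_le_sqrt
      gcongr
      exact hd i
    · rw [ht, Fin.append_right]
  set D := diagCLM t with hD
  have hDm : MapsTo D (ball 0 δ) (ball (0 : Eucl (p + q)) (R / 8)) := by
    intro z hz
    rw [mem_ball_zero_iff] at hz ⊢
    calc ‖D z‖ ≤ c * ‖z‖ := norm_diagCLM_apply_le hc0 htc z
      _ < c * δ := by gcongr
      _ = R / 8 := by rw [hRdef]; ring
  set φ : Eucl (p + q) → Eucl (p + q) := fun z => x₀ + Q (Γ (D z)) with hφ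
  have hDn : ‖D‖ ≤ c := norm_diagCLM_le hc0 htc
  have hΓd : ∀ w ∈ ball (0 : Eucl (p + q)) (R / 8), DifferentiableAt ℝ Γ w := fun w hw =>
    hΓC.differentiableAt hw
  -- The translation by `x₀` is left out, since this bound includes values; derivatives are
  -- unaffected.
  have hφ' : CkBounded (m + 2) (1 * ((m + 2).factorial * C₁ * max 1 (c + C) ^ (m + 2)))
      (fun z => Q (Γ (D z))) (ball 0 δ) := by
    have h1 : CkBounded (m + 2) (c + C) (fun z => D z) (ball 0 δ) :=
      CkBounded.of_clm isOpen_ball D (hDn.trans (by linarith)) fun z hz =>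
        (mem_ball_zero_iff.1 (hDm hz)).le.trans (by linarith)
    refine (hΓC.comp hC₁ h1 hDm).clm
      (Q.toContinuousLinearEquiv : Eucl (p + q) →L[ℝ] Eucl (p + q)) ?_
    exact ContinuousLinearMap.opNorm_le_bound _ zero_le_one fun v => by
      rw [one_mul]; exact (Q.norm_map v).le
  have hfφ : fderiv ℝ φ = fderiv ℝ (fun z => Q (Γ (D z))) := by
    ext1 z
    rw [hφ, fderiv_const_add]
  have hfst : ∀ z i, (D z) (Fin.castAdd q i) = √(2 / |d (Fin.castAdd q i)|) * fstPart z i :=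
    fun z i => by
      rw [hD, diagCLM_apply, ht, Fin.append_left]
      rfl
  have hsnd : ∀ z, sndPart (D z) = c • sndPart z := fun z => by
    ext j
    simp [sndPart, hD, ht]
  obtain ⟨hα1, hα2⟩ := fderiv_comp_smul_sub_const c (f x₀) hν1 hν2
  refine ⟨φ, fun i => SignType.sign (d (Fin.castAdd q i)), fun y => ν (c • y) - f x₀,
    ?_, ?_, ?_, ?_, ?_, ?_, ?_, ?_, hα1, hα2, ?_⟩
  · refine isCkDiffeoOn_comp x₀ Q (D' := diagCLM fun j => (t j)⁻¹) (fun z => ?_) (fun z => ?_) hDm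
      hΓC.contDiffOn hΓm isOpen_ball hΨ hΨΓ hΓΨ
    all_goals
      ext j
      have := (htpos j).ne'
      simp only [hD, diagCLM_apply]
      field_simp
  · exact fun z hz => hsmall (R / 4) (by linarith) _ (hΓm (hDm hz)) hσK
  · simp [hφ, hΓ0]
  · exact fun z hz => (norm_fderiv_isometry_comp_le x₀ Q hDn (hΓd _ (hDm hz))
      (hΓn _ (hDm hz))).trans (two_mul_sqrt_le hK0 hσpos hσK)
  · intro i
    rcases lt_or_gt_of_ne (hd_ne i) with h | h
    · right; simp [sign_neg h]
    · left; simp [sign_pos h]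
  · intro z hz
    have h1 := hnormal (D z) (hDm hz)
    simp only [hfst, half_mul_sqrt_mul_sq (hd_ne _), hsnd] at h1
    rw [hφ]
    simp only [h1]
    ring
  · refine (hν.comp (contDiff_const_smul c).contDiffOn fun y hy => ?_).sub contDiffOn_const
    rw [mem_ball_zero_iff] at hy ⊢
    rw [norm_smul, Real.norm_of_nonneg hc0]
    calc c * ‖y‖ < c * δ := by gcongr
      _ = R / 8 := by rw [hRdef]; ring
  · simp [hν0]
  · intro j hj hjm z hz
    obtain ⟨i, rfl⟩ : ∃ i, j = i + 1 := ⟨j - 1, by omega⟩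
    rw [← norm_iteratedFDeriv_fderiv, hfφ, norm_iteratedFDeriv_fderiv]
    exact (hφ'.norm_le _ hjm z hz).trans (by linarith)

end Splitting

theorem theorem4p2 :
    ∃ M : ℝ → ℝ → ℕ → ℕ → ℝ, (∀ K σ p k, 0 < M K σ p k) ∧
      ∀ (p q k : ℕ) (_hk : 3 ≤ k) (U : Set (Eucl (p + q))) (_hU : IsOpen U)
        (x₀ : Eucl (p + q)) (_hx₀ : x₀ ∈ U) (f : Eucl (p + q) → ℝ) (_hf : ContDiffOn ℝ k f U)
        (K : ℝ) (_hK : CkNormLE k f U K)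
        (_hcrit : fderiv ℝ f x₀ = 0)
        (_hrank : Module.finrank ℝ (LinearMap.range (hessMap f x₀)) = p)
        (σ : ℝ) (_hσ : σ = singVal (hessMap f x₀) p)
        (_hball : ∀ z : Eucl (p + q),
          2 * K * Real.sqrt (1 + (K + 1) ^ 2 / σ ^ 2) * ‖z - x₀‖ < 1 → z ∈ U),
        ∃ (φ : Eucl (p + q) → Eucl (p + q)) (ε : Fin p → ℝ) (α : Eucl q → ℝ),
          IsCkDiffeoOn (k - 1) φ (ball 0 (splitRadius K σ p)) ∧
          MapsTo φ (ball 0 (splitRadius K σ p)) U ∧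
          φ 0 = x₀ ∧
          (∀ z ∈ ball (0 : Eucl (p + q)) (splitRadius K σ p),
            ‖fderiv ℝ φ z‖ ≤ 32 * (K + 1) ^ 5 / σ ^ (5 / 2 : ℝ)) ∧
          (∀ i, ε i = 1 ∨ ε i = -1) ∧
          (∀ z ∈ ball (0 : Eucl (p + q)) (splitRadius K σ p),
            f (φ z) = f x₀ + ∑ i, ε i * fstPart z i ^ 2 + α (sndPart z)) ∧
          ContDiffOn ℝ k α (ball 0 (splitRadius K σ p)) ∧
          α 0 = 0 ∧ fderiv ℝ α 0 = 0 ∧ iteratedFDeriv ℝ 2 α 0 = 0 ∧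
          CkNormLE (k - 1) φ (ball 0 (splitRadius K σ p)) (M K σ p k) := by
  choose M hM h using exists_splitting
  -- Truncated subtraction gives a harmless value for `k < 3`.
  refine ⟨fun K σ p k => M K σ p (k - 3), fun K σ p k => hM K σ p _, ?_⟩
  intro p q k hk U hU x₀ hx₀ f hf K hK hcrit hrank σ hσ hball
  obtain ⟨m, rfl⟩ : ∃ m, k = m + 3 := ⟨k - 3, by omega⟩
  exact h K σ p m q U hU x₀ hx₀ f hf hK hcrit hrank hσ hball
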